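/- Let $k$ be an algebraically closed field of characteristic $0$. A variety over $k$ is a reduced separated scheme of finite type over $k$ (possibly reducible), and an algebraic group is a group object in varieties. Let $G$ be an algebraic group acting algebraically on a variety $X$. A *pseudo-quotient* for the action is a surjective $G$-invariant morphism of varieties $\pi : X \to Y$ such that $\overline{\pi(W_1)} \cap \overline{\pi(W_2)} = \emptyset$ for any two disjoint closed $G$-invariant sets $W_1, W_2 \subseteq X$. A *good quotient* is a morphism $\pi : X \to Y$ such that: (i) $\pi$ is $G$-invariant; (ii) $\pi$ is surjective; (iii) for every open $U \subseteq Y$, $\pi^*$ is an isomorphism $\mathcal{O}_Y(U) \to \mathcal{O}_X(\pi^{-1}(U))^G$; (iv) $\pi(W)$ is closed for every closed $G$-invariant $W \subseteq X$; (v) for closed $G$-invariant $W_1, W_2 \subseteq X$, $W_1 \cap W_2 = \emptyset$ if and only if $\pi(W_1) \cap \pi(W_2) = \emptyset$. Then: 1. If $\pi_1 : X \to Y_1$ and $\pi_2 : X \to Y_2$ are any two pseudo-quotients for the action of $G$ on $X$, then $[Y_1] = [Y_2]$ in the Grothendieck ring of varieties $K(\mathbf{Var}_k)$, that is, the ring generated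 by the isomorphism classes $[V]$ of varieties over $k$ with the relations $[V] = [Z] + [V \setminus Z]$ for $Z \subseteq V$ a closed subvariety, product $[V]\cdot[V'] = [V \times V']$, and unit the class of a point. 2. If $\pi : X \to Y$ is a pseudo-quotient for the action of $G$ on $X$, $X$ is irreducible and $Y$ is normal, then $\pi$ is a good quotient. -/

import Mathlib

open CategoryTheory AlgebraicGeometry MonoidalCategory CartesianMonoidalCategory

universe u

noncomputable section

namespace PseudoQuotient

variable {k : Type u} [Field k]

/-- An algebraic variety over `k`: a reduced separated scheme of finite type over `k`
(not necessarily irreducible, possibly empty). -/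
structure IsVariety (X : Over (Spec (.of k))) : Prop where
  isReduced : IsReduced X.left
  isSeparated : IsSeparated X.hom
  locallyOfFiniteType : LocallyOfFiniteType X.hom
  quasiCompact : QuasiCompact X.hom

/-- A scheme is normal if all its local rings are integrally closed domains. -/
def IsNormal (X : Scheme.{u}) : Prop :=
  ∀ x : X, IsDomain (X.presheaf.stalk x) ∧ IsIntegrallyClosed (X.presheaf.stalk x)

section Action

variable (G : Over (Spec (.of k))) [GrpObj G] {X Y : Over (Spec (.of k))} [ModObj G X]

/-- The action map `G × X ⟶ X`, `(g, x) ↦ g x`. -/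
abbrev act (X : Over (Spec (.of k))) [ModObj G X] : G ⊗ X ⟶ X := ModObj.smul (M := G) (X := X)

variable {G} in
/-- The morphism `X ⟶ X`, `x ↦ g x`, for a rational point `g ∈ G(k)`. -/
def translate (g : 𝟙_ (Over (Spec (.of k))) ⟶ G) (X : Over (Spec (.of k))) [ModObj G X] : X ⟶ X :=
  lift (toUnit X ≫ g) (𝟙 X) ≫ act G X

/-- `π` is `G`-invariant: `π (g x) = π x`, as an equality of morphisms `G × X ⟶ Y`. -/
def IsInvariantHom (π : X ⟶ Y) : Prop :=
  act G X ≫ π = snd G X ≫ π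

/-- `W ⊆ X` is `G`-invariant: `g W ⊆ W` for all `g ∈ G(k)`. -/
def IsInvariantSet (W : Set X.left) : Prop :=
  ∀ g : 𝟙_ (Over (Spec (.of k))) ⟶ G, ∀ x ∈ W, (translate g X).left x ∈ W

/-- A regular function `f` on an open `V ⊆ X` is `G`-invariant: every `g ∈ G(k)` maps `V` into `V`
and the pullback of `f` along `g : V ⟶ V` is `f`. -/
def IsInvariantSection {V : X.left.Opens} (f : Γ(X.left, V)) : Prop :=
  ∀ g : 𝟙_ (Over (Spec (.of k))) ⟶ G,
    ∃ h : V ≤ (translate g X).left ⁻¹ᵁ V, (translate g X).left.appLE V V h f = f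

/-- A pseudo-quotient for the action of `G` on `X`. -/
structure IsPseudoQuotient (π : X ⟶ Y) : Prop where
  invariant : IsInvariantHom G π
  surjective : Function.Surjective π.left
  disjoint_closure : ∀ W₁ W₂ : Set X.left, IsClosed W₁ → IsClosed W₂ →
    IsInvariantSet G W₁ → IsInvariantSet G W₂ → Disjoint W₁ W₂ →
      Disjoint (closure (π.left '' W₁)) (closure (π.left '' W₂))

/-- A good quotient for the action of `G` on `X`. -/
structure IsGoodQuotient (π : X ⟶ Y) : Prop where
  invariant : IsInvariantHom G π
  surjective : Function.Surjective π.left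
  /-- The ring map `π^*` is an isomorphism from `𝒪_Y(U)` onto the `G`-invariants of
  `𝒪_X(π⁻¹(U))`. -/
  bijOn : ∀ U : Y.left.Opens,
    Set.BijOn (π.left.app U) Set.univ {f : Γ(X.left, π.left ⁻¹ᵁ U) | IsInvariantSection G f}
  isClosed_image : ∀ W : Set X.left, IsClosed W → IsInvariantSet G W → IsClosed (π.left '' W)
  disjoint_iff : ∀ W₁ W₂ : Set X.left, IsClosed W₁ → IsClosed W₂ →
    IsInvariantSet G W₁ → IsInvariantSet G W₂ →
      (Disjoint W₁ W₂ ↔ Disjoint (π.left '' W₁) (π.left '' W₂))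

end Action

section GrothendieckRing

variable (k) in
/-- The type of algebraic varieties over `k`. -/
abbrev Var : Type (u + 1) := {X : Over (Spec (.of k)) // IsVariety X}

variable (k) in
/-- The relations of the Grothendieck ring of varieties, in the polynomial ring on all varieties:
isomorphic varieties agree, `[X] = [Z] + [U]` for a closed subvariety `Z` of `X` with open
complement `U`, the class of `X × Y` is the product `[X] [Y]`, and the class of a point is `1`.
(For `k` algebraically closed the product of two varieties is again a variety, so that the relation
`prod` applies to all pairs.) -/
inductive K₀Rel : MvPolynomial (Var k) ℤ → Prop
  | iso (X Y : Var k) (e : X.1 ≅ Y.1) : K₀Rel (.X X - .X Y)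
  | scissor (X Z U : Var k) (i : Z.1 ⟶ X.1) (j : U.1 ⟶ X.1)
      (hi : IsClosedImmersion i.left) (hj : IsOpenImmersion j.left)
      (hij : Set.range j.left = (Set.range i.left)ᶜ) : K₀Rel (.X X - (.X Z + .X U))
  | prod (X Y P : Var k) (e : P.1 ≅ X.1 ⊗ Y.1) : K₀Rel (.X P - .X X * .X Y)
  | unit (P : Var k) (e : P.1 ≅ 𝟙_ (Over (Spec (.of k)))) : K₀Rel (.X P - 1)

variable (k) in
/-- The Grothendieck ring of algebraic varieties over `k`. -/
abbrev K₀ : Type (u + 1) := MvPolynomial (Var k) ℤ ⧸ Ideal.span {p | K₀Rel k p}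

/-- The class `[X]` of a variety in the Grothendieck ring. -/
def K₀.of (X : Over (Spec (.of k))) (hX : IsVariety X) : K₀ k :=
  Ideal.Quotient.mk _ (MvPolynomial.X ⟨X, hX⟩)

end GrothendieckRing

end PseudoQuotient

end

/-! A pseudo-quotient is determined topologically by the action. Let `Z ⊆ Y₁` be closed and `W` its
preimage in `X`. A closed point `x` outside `W` has a closed invariant `π₁`-fibre disjoint from `W`,
so `π₂ x` stays off the closure of `π₂(W)`. Hence `Y₁` and `Y₂` pull back to the same topology on
`X` (`IsPseudoQuotient.induced_eq`), and in particular `π₁` and `π₂` have the same fibres. Nothing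
else about `G` enters part 1.

In characteristic 0 a function `f` constant on fibres is a fraction of functions on the base: `f ⊗ 1
- 1 ⊗ f` vanishes at the rational points of the fibre square, hence is nilpotent, and over the
perfect function field of the base this forces `f` into that field (`exists_mul_eq_algebraMap`). So
each of `π₁`, `π₂` factors through the other over a nonempty open set, and `Y₁`, `Y₂` share
isomorphic open subschemes with equal preimages (`exists_opens_iso`). Their complements satisfy the
same hypotheses, and noetherian induction gives equality of classes.

For part 2, an invariant function takes a single value at the rational points of a closed fibre,
since its level sets there are disjoint invariant closed sets. It is therefore a fraction of
functions on `Y`; normality and surjectivity make the fraction regular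
(`exists_algebraMap_eq_of_mul_eq`), and the local descents glue. Images of invariant closed sets are
closed by the fibre argument together with Chevalley's theorem. -/

namespace PseudoQuotient

/-! ### Commutative algebra: functions constant on fibres, and regularity of fractions -/

section Algebra

open scoped TensorProduct nonZeroDivisors

/-- If `a ⊗ 1 - 1 ⊗ a` is nilpotent in `B ⊗ B`, where `B` is a reduced algebra over a perfect
field `K`, then `a` belongs to `K`. -/
theorem mem_range_algebraMap_of_isNilpotent {K B : Type*} [Field K] [PerfectField K] [CommRing B]
    [Algebra K B] [IsReduced B] (a : B)
    (ha : IsNilpotent (a ⊗ₜ[K] (1 : B) - (1 : B) ⊗ₜ[K] a)) :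
    a ∈ Set.range (algebraMap K B) := by
  classical
  set g := minpoly K a with hg
  let φ : Polynomial K →ₐ[K] B := Polynomial.aeval a
  have hker : RingHom.ker φ = Ideal.span {g} := minpoly.ker_aeval_eq_span_minpoly K a
  let Q := Polynomial K ⧸ RingHom.ker φ
  let j : Q →ₐ[K] B := Ideal.kerLiftAlg φ
  have hj : Function.Injective j := Ideal.kerLiftAlg_injective φ
  let x : Q := Ideal.Quotient.mk _ Polynomial.X
  have hjx : j x = a :=
    (Ideal.kerLiftAlg_mk φ Polynomial.X).trans (Polynomial.aeval_X a)
  have hjj : Function.Injective (Algebra.TensorProduct.map j j) := by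
    have h1 : Function.Injective (LinearMap.rTensor Q j.toLinearMap) :=
      Module.Flat.rTensor_preserves_injective_linearMap _ hj
    have h2 : Function.Injective (LinearMap.lTensor B j.toLinearMap) :=
      Module.Flat.lTensor_preserves_injective_linearMap _ hj
    have : ⇑(Algebra.TensorProduct.map j j) =
        LinearMap.lTensor B j.toLinearMap ∘ LinearMap.rTensor Q j.toLinearMap := by
      rw [← LinearMap.coe_comp, LinearMap.lTensor_comp_rTensor]
      rfl
    rw [this]
    exact h2.comp h1
  have hx : IsNilpotent (x ⊗ₜ[K] (1 : Q) - (1 : Q) ⊗ₜ[K] x) := by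
    rw [← IsNilpotent.map_iff hjj]
    simpa [hjx] using ha
  -- Two roots of `g` define a map from `Q ⊗ Q` that sends the nilpotent element to their
  -- difference, which must vanish in a reduced ring. So `g` has at most one root in any reduced
  -- `K`-algebra.
  have key : ∀ {R : Type _} [CommRing R] [Algebra K R] [IsReduced R] (r s : R),
      Polynomial.aeval r g = 0 → Polynomial.aeval s g = 0 → r = s := by
    intro R _ _ _ r s hr hs
    let ev : ∀ r : R, Polynomial.aeval r g = 0 → (Q →ₐ[K] R) := fun r hr ↦
      Ideal.Quotient.liftₐ _ (Polynomial.aeval r) (by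
        intro p hp
        rw [hker, Ideal.mem_span_singleton] at hp
        obtain ⟨q, rfl⟩ := hp
        simp [hr])
    have hev : ∀ r hr, ev r hr x = r := fun r hr ↦ Polynomial.aeval_X r
    let m := Algebra.TensorProduct.lift (ev r hr) (ev s hs) (fun _ _ ↦ Commute.all _ _)
    have h := hx.map m
    simp only [map_sub, m, Algebra.TensorProduct.lift_tmul, hev, map_one, mul_one, one_mul] at h
    exact sub_eq_zero.1 h.eq_zero
  by_cases h0 : g = 0
  -- If `a` were transcendental, every element would be a root of `g = 0`, even `X` and `X + 1`.
  · have := key (R := Polynomial K) Polynomial.X (Polynomial.X + 1) (by simp [h0]) (by simp [h0])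
    simp at this
  have hint : IsIntegral K a := by
    by_contra h
    exact h0 (minpoly.eq_zero h)
  have hmonic : g.Monic := minpoly.monic hint
  -- Reducedness of `B` makes `g` squarefree and perfectness of `K` makes it separable, so its
  -- degree counts its roots in the algebraic closure.
  have hsep : g.Separable := PerfectField.separable_iff_squarefree.2
    ((minpoly.isRadical K a).squarefree h0)
  let gΩ := g.map (algebraMap K (AlgebraicClosure K))
  have hnodup : gΩ.roots.Nodup := Polynomial.nodup_roots (hsep.map)
  have hcard : gΩ.roots.card = g.natDegree := by
    rw [← Polynomial.natDegree_map (algebraMap K (AlgebraicClosure K)) (p := g)]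
    exact ((IsAlgClosed.splits gΩ).natDegree_eq_card_roots).symm
  have hle : g.natDegree ≤ 1 := by
    rw [← hcard]
    rw [← Multiset.toFinset_card_of_nodup hnodup, Finset.card_le_one]
    intro r hr s hs
    rw [Multiset.mem_toFinset, Polynomial.mem_roots', Polynomial.IsRoot.def,
      Polynomial.eval_map_algebraMap] at hr hs
    exact key r s hr.2 hs.2
  have ha0 : Polynomial.aeval a g = 0 := minpoly.aeval K a
  rcases Nat.le_one_iff_eq_zero_or_eq_one.1 hle with h | h
  · rw [hmonic.natDegree_eq_zero.1 h] at ha0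
    have : Subsingleton B := subsingleton_of_zero_eq_one (by simpa using ha0.symm)
    exact ⟨0, Subsingleton.elim _ _⟩
  · rw [hmonic.eq_X_add_C h] at ha0
    exact ⟨-g.coeff 0, by simpa [neg_eq_iff_add_eq_zero, add_comm] using ha0⟩

/-- In an algebra of finite type over an algebraically closed field, an element that vanishes at
all rational points is nilpotent. -/
theorem isNilpotent_of_forall_algHom {k T : Type*} [Field k] [IsAlgClosed k] [CommRing T]
    [Algebra k T] [Algebra.FiniteType k T] (e : T) (he : ∀ x : T →ₐ[k] k, x e = 0) :
    IsNilpotent e := by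
  have : IsJacobsonRing T := isJacobsonRing_of_finiteType (A := k)
  rw [← mem_nilradical, nilradical, Ideal.zero_eq_bot, Ideal.radical_eq_jacobson, Ideal.jacobson,
    Ideal.mem_sInf]
  rintro M ⟨-, hM⟩
  let _ : Field (T ⧸ M) := Ideal.Quotient.field M
  have : Module.Finite k (T ⧸ M) := finite_of_finite_type_of_isJacobsonRing k (T ⧸ M)
  let ε := AlgEquiv.ofBijective (Algebra.ofId k (T ⧸ M))
    IsAlgClosed.algebraMap_bijective_of_isIntegral
  have h := he (ε.symm.toAlgHom.comp (Ideal.Quotient.mkₐ k M))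
  rw [AlgHom.comp_apply] at h
  have h' : Ideal.Quotient.mkₐ k M e = 0 := by
    apply ε.symm.injective
    simpa using h
  exact Ideal.Quotient.eq_zero_iff_mem.1 h'

/-- A function on `Spec B` that is constant on the fibres of `Spec B → Spec A` is a fraction of
functions on `Spec A`. -/
theorem exists_mul_eq_algebraMap {k A B : Type*} [Field k] [IsAlgClosed k] [CharZero k]
    [CommRing A] [IsDomain A] [CommRing B] [IsReduced B] [Algebra k A] [Algebra k B] [Algebra A B]
    [IsScalarTower k A B] [Algebra.FiniteType k B] (f : B)
    (hf : ∀ x x' : B →ₐ[k] k, (∀ a : A, x (algebraMap A B a) = x' (algebraMap A B a)) →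
      x f = x' f) :
    ∃ s b : A, s ≠ 0 ∧ algebraMap A B s * f = algebraMap A B b := by
  have : Algebra.FiniteType A B := .of_restrictScalars_finiteType k A B
  have : Algebra.FiniteType B (B ⊗[A] B) := inferInstance
  have : IsScalarTower k B (B ⊗[A] B) := inferInstance
  have : Algebra.FiniteType k (B ⊗[A] B) := .trans (S := B) inferInstance inferInstance
  -- A rational point of the fibre square is a pair of rational points of `Spec B` with the same
  -- image in `Spec A`, and `f` agrees on such a pair.
  have hnil : IsNilpotent (f ⊗ₜ[A] (1 : B) - (1 : B) ⊗ₜ[A] f) := by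
    refine isNilpotent_of_forall_algHom (k := k) _ fun x ↦ ?_
    let i₁ : B →ₐ[k] B ⊗[A] B := Algebra.TensorProduct.includeLeft
    let i₂ : B →ₐ[k] B ⊗[A] B := Algebra.TensorProduct.includeRight.restrictScalars k
    have h := hf (x.comp i₁) (x.comp i₂) fun a ↦ by
      exact congr_arg x <| Algebra.TensorProduct.tmul_one_eq_one_tmul (R := A) (A := B) (B := B) a
    rw [map_sub, sub_eq_zero]
    exact h
  let K := FractionRing A
  have : CharZero A := charZero_of_injective_algebraMap (algebraMap k A).injective
  have : CharZero K := charZero_of_injective_algebraMap (IsFractionRing.injective A K)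
  let BK := Localization (Algebra.algebraMapSubmonoid B A⁰)
  let _ : Algebra K BK := localizationAlgebra A⁰ B
  have : IsScalarTower A K BK := 
    isScalarTower_localizationAlgebra A⁰ B
  have : _root_.IsReduced BK := isReduced_localizationPreserves (Algebra.algebraMapSubmonoid B A⁰) BK ‹_›
  let i₁ : BK →ₐ[K] BK ⊗[K] BK := Algebra.TensorProduct.includeLeft
  let i₂ : BK →ₐ[K] BK ⊗[K] BK := Algebra.TensorProduct.includeRight
  let m : B ⊗[A] B →ₐ[A] BK ⊗[K] BK := Algebra.TensorProduct.lift
    ((i₁.restrictScalars A).comp (IsScalarTower.toAlgHom A B BK))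
    ((i₂.restrictScalars A).comp (IsScalarTower.toAlgHom A B BK))
    (fun _ _ ↦ Commute.all _ _)
  obtain ⟨c, hc⟩ := mem_range_algebraMap_of_isNilpotent (K := K) (algebraMap B BK f) (by
    simpa [m, i₁, i₂] using hnil.map m)
  obtain ⟨b, s, rfl⟩ := IsLocalization.exists_mk'_eq A⁰ c
  have h1 : algebraMap B BK (algebraMap A B s * f) = algebraMap B BK (algebraMap A B b) := by
    rw [map_mul, ← hc, ← IsScalarTower.algebraMap_apply, ← IsScalarTower.algebraMap_apply,
      IsScalarTower.algebraMap_apply A K BK, IsScalarTower.algebraMap_apply A K BK, ← map_mul,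
      IsLocalization.mk'_spec']
  obtain ⟨⟨_, t, ht, rfl⟩, h2⟩ :=
    (IsLocalization.eq_iff_exists (Algebra.algebraMapSubmonoid B A⁰) BK).1 h1
  -- The relation holds in a localization of `B`; the factor `t` kills the torsion that separates it
  -- from a relation in `B`.
  refine ⟨t * s, t * b, mul_ne_zero (nonZeroDivisors.ne_zero ht) (nonZeroDivisors.ne_zero s.2), ?_⟩
  simpa [mul_assoc] using h2

/-- If every element of a finitely generated algebra `C` becomes a fraction of elements of `A` in
`B ⊇ A`, then `C → B` factors through `A` after inverting one element of `A`. -/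
theorem exists_algHom_away {k A B C : Type*} [CommRing k] [CommRing A] [IsDomain A]
    [CommRing B] [CommRing C] [Algebra k A] [Algebra k B] [Algebra k C] [Algebra.FiniteType k C]
    (φ : A →ₐ[k] B) (hφ : Function.Injective φ) (ψ : C →ₐ[k] B)
    (h : ∀ c : C, ∃ s b : A, s ≠ 0 ∧ φ s * ψ c = φ b) :
    ∃ s : A, s ≠ 0 ∧ ∃ χ : C →ₐ[k] Localization.Away s, ∀ c : C,
      Localization.awayMap φ.toRingHom s (χ c) =
        algebraMap B (Localization.Away (φ.toRingHom s)) (ψ c) := by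
  classical
  obtain ⟨F, hF⟩ := Algebra.FiniteType.out (R := k) (A := C)
  choose s b hs hb using h
  -- A common denominator for the finitely many generators of `C`.
  let S := ∏ c ∈ F, s c
  have hS : S ≠ 0 := Finset.prod_ne_zero_iff.2 fun c _ ↦ hs c
  have hηA' : ∀ a : A, Localization.awayMap φ.toRingHom S (algebraMap A _ a) =
      algebraMap B (Localization.Away (φ.toRingHom S)) (φ a) := fun a ↦
    IsLocalization.map_eq _ _
  let η : Localization.Away S →ₐ[k] Localization.Away (φ.toRingHom S) :=
    { Localization.awayMap φ.toRingHom S with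
      commutes' := fun r ↦ by
        rw [IsScalarTower.algebraMap_apply k A (Localization.Away S)]
        refine (hηA' _).trans ?_
        rw [IsScalarTower.algebraMap_apply k B (Localization.Away (φ.toRingHom S))]
        congr 1
        exact φ.commutes r }
  have hηA : ∀ a : A, η (algebraMap A _ a) = algebraMap B _ (φ a) := hηA'
  have hη : Function.Injective η := IsLocalization.map_injective_of_injective _ _ _ hφ
  let ι : C →ₐ[k] Localization.Away (φ.toRingHom S) := (IsScalarTower.toAlgHom k B _).comp ψ
  have hmem : ∀ c, ι c ∈ η.range := by
    have : Algebra.adjoin k (F : Set C) ≤ η.range.comap ι := by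
      refine Algebra.adjoin_le fun c hc ↦ ?_
      have hdvd : s c ∣ S := Finset.dvd_prod_of_mem _ hc
      obtain ⟨t, ht⟩ := hdvd
      refine ⟨IsLocalization.mk' _ (t * b c) (⟨S, Submonoid.mem_powers S⟩ : Submonoid.powers S), ?_⟩
      have hu : IsUnit (algebraMap B (Localization.Away (φ.toRingHom S)) (φ S)) :=
        IsLocalization.Away.algebraMap_isUnit (S := Localization.Away (φ.toRingHom S))
          (φ.toRingHom S)
      refine hu.mul_left_cancel ?_
      rw [← hηA S]
      change η _ * η _ = _
      rw [← map_mul, mul_comm, IsLocalization.mk'_spec]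
      rw [hηA, hηA]
      change _ = _ * algebraMap B _ (ψ c)
      rw [← map_mul]
      congr 1
      rw [map_mul, ← hb c, congr_arg φ ht, map_mul]
      ring
    intro c
    exact this (hF ▸ Algebra.mem_top)
  let e := AlgEquiv.ofInjective η hη
  refine ⟨S, hS, e.symm.toAlgHom.comp (ι.codRestrict η.range hmem), fun c ↦ ?_⟩
  change η (e.symm ⟨ι c, hmem c⟩) = ι c
  exact congr_arg Subtype.val (e.apply_symm_apply ⟨ι c, hmem c⟩)

/-- A fraction of elements of a normal domain `A` that is regular on a scheme surjecting onto
`Spec A` is regular on `Spec A`. -/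
theorem exists_algebraMap_eq_of_mul_eq {A B : Type*} [CommRing A] [IsDomain A]
    [IsNoetherianRing A] [IsIntegrallyClosed A] [CommRing B] [IsDomain B] (φ : A →+* B)
    (hφ : Function.Injective φ)
    (hsurj : ∀ P : Ideal A, P.IsPrime → ∃ Q : Ideal B, Q.IsPrime ∧ Q.comap φ = P)
    (f : B) (s b : A) (hs : s ≠ 0) (hf : φ s * f = φ b) : ∃ a, φ a = f := by
  have hs' : φ s ≠ 0 := (map_ne_zero_iff φ hφ).2 hs
  suffices s ∣ b by
    obtain ⟨a, rfl⟩ := this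
    exact ⟨a, mul_left_cancel₀ hs' (by rw [hf, map_mul])⟩
  by_contra hb
  let x : A ⧸ Ideal.span {s} := Ideal.Quotient.mk _ b
  have hx : x ≠ 0 := fun h ↦ hb (Ideal.mem_span_singleton.1 (Ideal.Quotient.eq_zero_iff_mem.1 h))
  let N := Submodule.span A {x}
  have : Nontrivial N :=
    ⟨⟨⟨x, Submodule.mem_span_singleton_self x⟩, 0, fun h ↦ hx (congr_arg Subtype.val h)⟩⟩
  -- An associated prime of the module generated by the class of `b` modulo `s`: for some `c`, `P`
  -- is the set of `p` with `s ∣ p * (c * b)`. Everything below studies the fraction `z = c b / s`,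
  -- which maps `P` into `A`.
  obtain ⟨P, hP'⟩ := associatedPrimes.nonempty A N
  obtain ⟨hP, ⟨y, hy⟩, hPy⟩ := isAssociatedPrime_iff.1 hP'
  obtain ⟨c, hc⟩ := Submodule.mem_span_singleton.1 hy
  have hmem : ∀ p, p ∈ P ↔ s ∣ p * (c * b) := fun p ↦ by
    rw [hPy, Submodule.mem_colon_singleton, Submodule.mem_bot, ← Ideal.mem_span_singleton,
      ← Ideal.Quotient.eq_zero_iff_mem]
    subst hc
    exact Subtype.ext_iff
  have hsP : s ∈ P := (hmem s).2 (dvd_mul_right _ _)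
  -- If `z P ⊆ P`, then `z` preserves a nonzero finitely generated ideal, so it is integral, hence
  -- in `A`; this puts `1` in `P`.
  by_cases hst : ∀ p ∈ P, ∀ q, p * (c * b) = s * q → q ∈ P
  · let z : (FractionRing A) := algebraMap A (FractionRing A) (c * b) / algebraMap A (FractionRing A) s
    have hsK : algebraMap A (FractionRing A) s ≠ 0 := (map_ne_zero_iff _ (IsFractionRing.injective A (FractionRing A))).2 hs
    have hz : IsIntegral A z := by
      refine isIntegral_of_smul_mem_submodule (M := (FractionRing A)) (Submodule.map (Algebra.linearMap A (FractionRing A)) P) ?_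
        ((IsNoetherian.noetherian P).map _) z ?_
      · intro h
        have : algebraMap A (FractionRing A) s ∈ Submodule.map (Algebra.linearMap A (FractionRing A)) P :=
          Submodule.mem_map_of_mem (f := Algebra.linearMap A (FractionRing A)) hsP
        rw [h] at this
        exact hsK this
      · rintro _ ⟨p, hp, rfl⟩
        obtain ⟨q, hq⟩ := (hmem p).1 hp
        refine ⟨q, hst p hp q hq, ?_⟩
        have hq' := congr_arg (algebraMap A (FractionRing A)) hq
        simp only [map_mul] at hq'
        simp only [Algebra.linearMap_apply, smul_eq_mul, z, map_mul]
        field_simp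
        linear_combination -hq'
    obtain ⟨a, ha⟩ := IsIntegrallyClosed.algebraMap_eq_of_integral (K := (FractionRing A)) hz
    have h1 : c * b = s * a := by
      apply IsFractionRing.injective A (FractionRing A)
      rw [map_mul _ s, ha, mul_div_cancel₀ _ hsK]
    exact hP.ne_top ((Ideal.eq_top_iff_one P).2 ((hmem 1).2 ⟨a, by rw [one_mul, h1]⟩))
  · push Not at hst
    obtain ⟨p, hp, q, hpq, hq⟩ := hst
    -- Otherwise `p z = q` with `p ∈ P` and `q ∉ P`. In `B` the fraction `z` becomes the regular
    -- element `φ c * f`, so `φ q` lies in any prime `Q` above `P`, a contradiction.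
    obtain ⟨Q, hQ, rfl⟩ := hsurj P hP
    apply hq
    have h1 : φ p * (φ c * f) = φ q := by
      apply mul_left_cancel₀ hs'
      rw [← map_mul φ s q, ← hpq, map_mul, map_mul, ← hf]
      ring
    rw [Ideal.mem_comap, ← h1]
    exact Ideal.mul_mem_right _ _ hp

end Algebra

/-! ### Affine covers and reduced closed subschemes -/

section Schemes

/-- A quasi-compact reduced scheme is the image of a reduced affine scheme under a morphism locally
of finite type. -/
theorem exists_affine_surjective (X : Scheme.{u}) [CompactSpace X] [IsReduced X] :
    ∃ (B : CommRingCat.{u}) (q : Spec B ⟶ X), Function.Surjective q ∧ LocallyOfFiniteType q ∧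
      IsReduced (Spec B) := by
  let 𝒰 : X.OpenCover := X.affineCover.finiteSubcover
  have h𝒰 (i : 𝒰.I₀) : IsOpenImmersion (𝒰.f i) := 𝒰.map_prop i
  have : IsZariskiLocalAtSource (@LocallyOfFiniteType : MorphismProperty Scheme.{u}) :=
    HasRingHomProperty.instIsZariskiLocalAtSource (Q := RingHom.FiniteType)
  have h1 : LocallyOfFiniteType (Limits.Sigma.desc 𝒰.f) :=
    this.sigmaDesc fun i ↦ inferInstance
  have hr (i : 𝒰.I₀) : IsReduced (𝒰.X i) := isReduced_of_isOpenImmersion (𝒰.f i)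
  have h2 : IsReduced (∐ 𝒰.X) :=
    (IsReduced.iff_of_openCover _ (sigmaOpenCover 𝒰.X)).2 hr
  exact ⟨Γ(∐ 𝒰.X, ⊤), (∐ 𝒰.X).isoSpec.inv ≫ Limits.Sigma.desc 𝒰.f, Surjective.surj,
    inferInstance, isReduced_of_isOpenImmersion (∐ 𝒰.X).isoSpec.inv⟩

/-- Closed subsets of schemes carry reduced closed subscheme structures. -/
theorem exists_reduced_closedSubscheme {X : Scheme.{u}} (Z : Set X) (hZ : IsClosed Z) :
    ∃ (T : Scheme.{u}) (i : T ⟶ X), IsClosedImmersion i ∧ IsReduced T ∧ Set.range i = Z ∧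
      ∀ (W : Scheme.{u}) (f : W ⟶ X), IsReduced W → Set.range f ⊆ Z →
        ∃ g : W ⟶ T, g ≫ i = f := by
  let I := Scheme.IdealSheafData.vanishingIdeal (X := X) ⟨Z, hZ⟩
  have hI (U : X.affineOpens) : (I.ideal U).IsRadical := by
    simp only [I, Scheme.IdealSheafData.vanishingIdeal_ideal]
    exact PrimeSpectrum.isRadical_vanishingIdeal _
  refine ⟨I.subscheme, I.subschemeι, inferInstance, ?_, ?_, ?_⟩
  · refine (IsReduced.iff_of_openCover _ I.subschemeCover.openCover).2 fun U ↦ ?_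
    let U : X.affineOpens := U
    have : _root_.IsReduced (Γ(X, U) ⧸ I.ideal U) :=
      (Ideal.isRadical_iff_quotient_reduced _).1 (hI U)
    exact inferInstanceAs (IsReduced (Spec (.of (Γ(X, U) ⧸ I.ideal U))))
  · rw [Scheme.IdealSheafData.range_subschemeι]
    rfl
  · intro W f hW hf
    refine ⟨IsClosedImmersion.lift I.subschemeι f ?_, IsClosedImmersion.lift_fac _ _ _⟩
    rw [Scheme.IdealSheafData.ker_subschemeι]
    refine Scheme.IdealSheafData.le_ofIdeals_iff.2 fun U s hs ↦ ?_
    -- On the reduced scheme `W` a function is zero once its nonvanishing locus is empty, so only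
    -- points need checking.
    rw [RingHom.mem_ker, ← basicOpen_eq_bot_iff, ← Scheme.preimage_basicOpen, eq_bot_iff]
    intro w hw
    exfalso
    have hwU : f w ∈ (U : X.Opens) := X.basicOpen_le s hw
    rw [← SetLike.mem_coe, ← U.2.range_fromSpec] at hwU
    obtain ⟨p, hp⟩ := hwU
    have hpZ : p ∈ U.2.fromSpec ⁻¹' Z := by
      rw [Set.mem_preimage, hp]
      exact hf ⟨w, rfl⟩
    have hps : p ∈ U.2.fromSpec ⁻¹ᵁ X.basicOpen s := by
      change U.2.fromSpec p ∈ X.basicOpen s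
      rw [hp]
      exact hw
    rw [U.2.fromSpec_preimage_basicOpen] at hps
    simp only [I, Scheme.IdealSheafData.vanishingIdeal_ideal] at hs
    exact hps ((PrimeSpectrum.mem_vanishingIdeal _ _).1 hs p hpZ)

end Schemes

/-- If `Spec B → Spec C` is constant on the fibres of the dominant morphism `Spec B → Spec A`, then
it factors through `Spec A` over a nonempty basic open subset. -/
theorem exists_ringHom_away {k A B C : Type*} [Field k] [IsAlgClosed k] [CharZero k] [CommRing A]
    [IsDomain A] [CommRing B] [_root_.IsReduced B] [CommRing C] (α : k →+* A) (γ : k →+* C)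
    (φ : A →+* B) (ψ : C →+* B) (h : φ.comp α = ψ.comp γ) (hφ : Function.Injective φ)
    (hγ : γ.FiniteType) (hβ : (φ.comp α).FiniteType)
    (H : ∀ x x' : B →+* k, x.comp (φ.comp α) = .id k → x'.comp (φ.comp α) = .id k →
      x.comp φ = x'.comp φ → x.comp ψ = x'.comp ψ) :
    ∃ s : A, s ≠ 0 ∧ ∃ χ : C →+* Localization.Away s,
      χ.comp γ = (algebraMap A (Localization.Away s)).comp α ∧
      (Localization.awayMap φ s).comp χ = (algebraMap B (Localization.Away (φ s))).comp ψ := by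
  algebraize [α, γ, φ, φ.comp α]
  let φ' : A →ₐ[k] B := { φ with commutes' := fun _ ↦ rfl }
  let ψ' : C →ₐ[k] B := { ψ with commutes' := fun r ↦ (congr($h r)).symm }
  obtain ⟨s, hs, χ, hχ⟩ := exists_algHom_away φ' hφ ψ' fun c ↦ by
    obtain ⟨s, b, hs, hb⟩ := exists_mul_eq_algebraMap (k := k) (A := A) (ψ c) fun x x' hxx' ↦ by
      have := H x.toRingHom x'.toRingHom (RingHom.ext fun r ↦ x.commutes r)
        (RingHom.ext fun r ↦ x'.commutes r) (RingHom.ext hxx')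
      exact congr($this c)
    exact ⟨s, b, hs, hb⟩
  refine ⟨s, hs, χ.toRingHom, RingHom.ext fun r ↦ ?_, RingHom.ext hχ⟩
  exact (χ.commutes r).trans (IsScalarTower.algebraMap_apply k A (Localization.Away s) r)

/-! ### Varieties, and generic factorization through a surjection -/

section

variable {k : Type u} [Field k]

theorem IsVariety.isNoetherian {X : Over (Spec (.of k))} (hX : IsVariety X) :
    IsNoetherian X.left := by
  have := hX.locallyOfFiniteType
  have := hX.quasiCompact
  have : IsLocallyNoetherian X.left := LocallyOfFiniteType.isLocallyNoetherian X.hom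
  have : CompactSpace X.left := QuasiCompact.compactSpace_of_compactSpace X.hom
  constructor

theorem IsVariety.jacobsonSpace {X : Over (Spec (.of k))} (hX : IsVariety X) :
    JacobsonSpace X.left :=
  have := hX.locallyOfFiniteType
  LocallyOfFiniteType.jacobsonSpace X.hom

theorem IsVariety.of_isOpenImmersion {X : Over (Spec (.of k))} (hX : IsVariety X) {U : Scheme.{u}}
    (j : U ⟶ X.left) [IsOpenImmersion j] : IsVariety (Over.mk (j ≫ X.hom)) := by
  have := hX.1
  have := hX.2
  have := hX.3
  have := hX.4
  have := hX.isNoetherian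
  exact ⟨isReduced_of_isOpenImmersion j, inferInstanceAs (IsSeparated (j ≫ X.hom)),
    inferInstanceAs (LocallyOfFiniteType (j ≫ X.hom)), inferInstanceAs (QuasiCompact (j ≫ X.hom))⟩

theorem IsVariety.of_isClosedImmersion {X : Over (Spec (.of k))} (hX : IsVariety X)
    {Z : Scheme.{u}} (i : Z ⟶ X.left) [IsClosedImmersion i] [IsReduced Z] :
    IsVariety (Over.mk (i ≫ X.hom)) := by
  have := hX.2
  have := hX.3
  have := hX.4
  exact ⟨‹_›, inferInstanceAs (IsSeparated (i ≫ X.hom)),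
    inferInstanceAs (LocallyOfFiniteType (i ≫ X.hom)), inferInstanceAs (QuasiCompact (i ≫ X.hom))⟩

/-- Every nonempty open subset of a noetherian space contains a nonempty irreducible open subset. -/
theorem exists_isOpen_isIrreducible {T : Type*} [TopologicalSpace T]
    [TopologicalSpace.NoetherianSpace T] (O : Set T) (hO : IsOpen O) (hne : O.Nonempty) :
    ∃ V ⊆ O, IsOpen V ∧ IsIrreducible V := by
  obtain ⟨y, hy⟩ := hne
  obtain ⟨U, hU, hUne, hUZ⟩ :=
    TopologicalSpace.NoetherianSpace.exists_isOpen_nonempty_subset_irreducibleComponent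
      (irreducibleComponent (⟨y, hy⟩ : O)) (irreducibleComponent_mem_irreducibleComponents _)
  have hirr : IsPreirreducible U :=
    isIrreducible_irreducibleComponent.isPreirreducible.open_subset hU hUZ
  exact ⟨Subtype.val '' U, Subtype.coe_image_subset _ _, hO.isOpenMap_subtype_val U hU,
    hUne.image _, hirr.image _ continuous_subtype_val.continuousOn⟩

/-- Every nonempty open subset of a noetherian scheme contains a nonempty irreducible affine open
subset. -/
theorem exists_isAffineOpen_isIrreducible {Y : Scheme.{u}} [IsNoetherian Y] (O : Y.Opens)
    (hO : (O : Set Y).Nonempty) :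
    ∃ V : Y.Opens, V ≤ O ∧ IsAffineOpen V ∧ IsIrreducible (V : Set Y) := by
  obtain ⟨U, hUO, hU, hUirr⟩ := exists_isOpen_isIrreducible (O : Set Y) O.2 hO
  obtain ⟨y, hy⟩ := hUirr.nonempty
  obtain ⟨V, hV, hyV, hVU⟩ := exists_isAffineOpen_mem_and_subset (U := ⟨U, hU⟩) hy
  exact ⟨V, hVU.trans hUO, hV, ⟨y, hyV⟩, hUirr.isPreirreducible.open_subset V.2 hVU⟩

/-- A dominant morphism of affine schemes with reduced target is injective on functions. -/
theorem injective_of_surjective_specMap {A B : CommRingCat.{u}} [_root_.IsReduced A] (φ : A ⟶ B)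
    (h : Function.Surjective (Spec.map φ)) : Function.Injective φ.hom := by
  rw [RingHom.injective_iff_ker_eq_bot, eq_bot_iff]
  intro a ha
  have : a ∈ nilradical A := by
    rw [nilradical_eq_sInf, Ideal.mem_sInf]
    intro P hP
    obtain ⟨Q, hQ⟩ := h ⟨P, hP⟩
    have hQ' : Q.asIdeal.comap φ.hom = P := congr_arg PrimeSpectrum.asIdeal hQ
    rw [← hQ', Ideal.mem_comap, RingHom.mem_ker.1 ha]
    exact zero_mem _
  rw [nilradical_eq_zero] at this
  exact this

variable [IsAlgClosed k] [CharZero k]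

/-- If `π₁ : X ⟶ Y₁` and `π₂ : X ⟶ Y₂` are surjective and the Zariski topologies of `Y₁` and
`Y₂` pull back to the same topology of `X`, then `π₂` factors through `π₁` over a nonempty
open subset of `Y₁`. -/
theorem exists_opens_hom {X Y₁ Y₂ : Over (Spec (.of k))} (hX : IsVariety X) (hY₁ : IsVariety Y₁)
    (hY₂ : IsVariety Y₂) (π₁ : X ⟶ Y₁) (π₂ : X ⟶ Y₂) (h₁ : Function.Surjective π₁.left)
    (hind : ∀ x x' : X.left, π₁.left x = π₁.left x' → π₂.left x = π₂.left x')
    (O : Y₁.left.Opens) (hO : (O : Set Y₁.left).Nonempty)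
    (hcont : ∀ V : Y₂.left.Opens, ∃ W : Y₁.left.Opens, π₁.left ⁻¹ᵁ W = π₂.left ⁻¹ᵁ V) :
    ∃ U ≤ O, (U : Set Y₁.left).Nonempty ∧ ∃ φ : (U : Scheme.{u}) ⟶ Y₂.left,
      φ ≫ Y₂.hom = U.ι ≫ Y₁.hom ∧ ∀ (x : X.left) (y : (U : Scheme.{u})), π₁.left x = U.ι y → φ y = π₂.left x := by
  have := hX.1
  have := hY₁.1
  have := hX.3
  have := hY₁.3
  have := hY₂.3
  have := hX.isNoetherian
  have := hY₁.isNoetherian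
  obtain ⟨y, hy⟩ := hO
  obtain ⟨x, rfl⟩ := h₁ y
  obtain ⟨V₂, hV₂, hxV₂, -⟩ := exists_isAffineOpen_mem_and_subset (U := (⊤ : Y₂.left.Opens))
    (x := π₂.left x) trivial
  -- Over `W` the map `π₂` lands in the affine `V₂`, so factoring `π₂` becomes a question about
  -- functions.
  obtain ⟨W, hW⟩ := hcont V₂
  have hxW : x ∈ π₁.left ⁻¹ᵁ W := hW ▸ hxV₂
  obtain ⟨V₁, hV₁W, hV₁, hV₁irr⟩ := exists_isAffineOpen_isIrreducible (O ⊓ W) ⟨_, hy, hxW⟩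
  have : Nonempty V₁ := hV₁irr.nonempty.to_subtype
  have : IrreducibleSpace V₁ := isIrreducible_iff_irreducibleSpace.1 hV₁irr
  have : IsIntegral (V₁ : Scheme.{u}) := isIntegral_of_irreducibleSpace_of_isReduced _
  have : IsDomain Γ(Y₁.left, V₁) := (affine_isIntegral_iff _).1
    (isIntegral_of_isOpenImmersion hV₁.isoSpec.inv)
  let X₁ := π₁.left ⁻¹ᵁ V₁
  have : CompactSpace X₁ :=
    isCompact_iff_compactSpace.1 (TopologicalSpace.NoetherianSpace.isCompact _)
  -- `X₁` need not be affine; a reduced affine scheme of finite type surjecting onto it has the same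
  -- fibres over `V₁` up to surjection, which is all the argument needs.
  obtain ⟨B, q, hq, hqft, hB⟩ := exists_affine_surjective (X₁ : Scheme.{u})
  have : _root_.IsReduced B := (affine_isReduced_iff _).1 hB
  let f₁ : Spec Γ(Y₁.left, V₁) ⟶ Y₁.left := hV₁.fromSpec
  let f₂ : Spec Γ(Y₂.left, V₂) ⟶ Y₂.left := hV₂.fromSpec
  let g : Spec B ⟶ X.left := q ≫ X₁.ι
  have hg₁ : Set.range (g ≫ π₁.left) ⊆ Set.range f₁ := by
    rw [hV₁.range_fromSpec]
    rintro _ ⟨w, rfl⟩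
    exact (q w).2
  have hg₂ : Set.range (g ≫ π₂.left) ⊆ Set.range f₂ := by
    rw [hV₂.range_fromSpec]
    rintro _ ⟨w, rfl⟩
    have : (q w).1 ∈ π₁.left ⁻¹ᵁ W := (hV₁W (q w).2).2
    rw [hW] at this
    exact this
  obtain ⟨φ, hφ⟩ := Spec.map_surjective (IsOpenImmersion.lift f₁ (g ≫ π₁.left) hg₁)
  obtain ⟨ψ, hψ⟩ := Spec.map_surjective (IsOpenImmersion.lift f₂ (g ≫ π₂.left) hg₂)
  obtain ⟨α, hα⟩ := Spec.map_surjective (f₁ ≫ Y₁.hom)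
  obtain ⟨γ, hγ⟩ := Spec.map_surjective (f₂ ≫ Y₂.hom)
  have hφ' : Spec.map φ ≫ f₁ = g ≫ π₁.left := by rw [hφ, IsOpenImmersion.lift_fac]
  have hψ' : Spec.map ψ ≫ f₂ = g ≫ π₂.left := by rw [hψ, IsOpenImmersion.lift_fac]
  have hαφ : Spec.map (α ≫ φ) = g ≫ X.hom := by
    rw [Spec.map_comp, hα, reassoc_of% hφ', Over.w]
  have hγψ : Spec.map (γ ≫ ψ) = g ≫ X.hom := by
    rw [Spec.map_comp, hγ, reassoc_of% hψ', Over.w]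
  have hcomm : α ≫ φ = γ ≫ ψ := Spec.map_injective (hαφ.trans hγψ.symm)
  have hsurj : Function.Surjective (Spec.map φ) := by
    intro p
    obtain ⟨x, hx⟩ := h₁ (f₁ p)
    have hxX₁ : x ∈ X₁ := by
      change π₁.left x ∈ V₁
      rw [hx, ← SetLike.mem_coe, ← hV₁.range_fromSpec]
      exact ⟨p, rfl⟩
    obtain ⟨w, hw⟩ := hq ⟨x, hxX₁⟩
    refine ⟨w, f₁.isOpenEmbedding.injective ?_⟩
    rw [← Scheme.Hom.comp_apply, hφ', ← hx, Scheme.Hom.comp_apply, Scheme.Hom.comp_apply, hw]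
    rfl
  have hft₁ : (α ≫ φ).hom.FiniteType := by
    rw [← HasRingHomProperty.Spec_iff (P := @LocallyOfFiniteType), hαφ]
    infer_instance
  have hft₂ : γ.hom.FiniteType := by
    rw [← HasRingHomProperty.Spec_iff (P := @LocallyOfFiniteType), hγ]
    infer_instance
  obtain ⟨s, hs, χ, hχ₁, hχ₂⟩ := exists_ringHom_away α.hom γ.hom φ.hom ψ.hom
    (congr_arg CommRingCat.Hom.hom hcomm) (injective_of_surjective_specMap φ hsurj) hft₂ hft₁ (by
      intro x x' hx hx' hxx'
      let p := Spec.map (CommRingCat.ofHom x)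
      let p' := Spec.map (CommRingCat.ofHom x')
      have key (x : B →+* k) (hx : x.comp (φ.hom.comp α.hom) = .id k) :
          (Spec.map (CommRingCat.ofHom x) ≫ Spec.map ψ ≫ f₂) ≫ Y₂.hom = 𝟙 _ := by
        rw [Category.assoc, Category.assoc, ← hγ, ← Spec.map_comp, ← hcomm, ← Spec.map_comp,
          ← Spec.map_id]
        congr 1
        ext r
        exact congr($hx r)
      have hpt : (p ≫ Spec.map φ ≫ f₁) = (p' ≫ Spec.map φ ≫ f₁) := by
        simp only [p, p', ← Category.assoc, ← Spec.map_comp]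
        congr 2
        ext r
        exact congr($hxx' r)
      have hpt₂ : (p ≫ Spec.map ψ ≫ f₂) = (p' ≫ Spec.map ψ ≫ f₂) := by
        have hpoint (c : Spec (.of k)) :
            (p ≫ Spec.map ψ ≫ f₂ : Spec (.of k) ⟶ _) c = (p' ≫ Spec.map ψ ≫ f₂) c := by
          rw [hψ']
          change π₂.left ((p ≫ g) c) = π₂.left ((p' ≫ g) c)
          apply hind
          change (p ≫ g ≫ π₁.left) c = (p' ≫ g ≫ π₁.left) c
          rw [← hφ', hpt]
        -- Rational points are determined by their underlying points, so the set-theoretic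
        -- hypothesis `hind` suffices.
        exact ext_of_apply_closedPoint_eq Y₂.hom (key x hx) (key x' hx') (hpoint _)
      rw [← Category.assoc, ← Category.assoc, cancel_mono, ← Spec.map_comp, ← Spec.map_comp] at hpt₂
      exact congr_arg CommRingCat.Hom.hom (Spec.map_injective hpt₂))
  let j : Spec (.of (Localization.Away s)) ⟶ Y₁.left :=
    Spec.map (CommRingCat.ofHom (algebraMap _ (Localization.Away s))) ≫ f₁
  have : IsOpenImmersion j := inferInstance
  let e : Spec (.of (Localization.Away s)) ≅ j.opensRange := j.isoOpensRange
  have he : e.inv ≫ j = j.opensRange.ι := j.isoOpensRange_inv_comp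
  have hle : j.opensRange ≤ V₁ := by
    rintro _ ⟨t, rfl⟩
    exact hV₁.range_fromSpec.le ⟨_, rfl⟩
  refine ⟨j.opensRange, hle.trans (hV₁W.trans inf_le_left), ?_,
    e.inv ≫ Spec.map (CommRingCat.ofHom χ) ≫ f₂, ?_, ?_⟩
  · have : Nontrivial (Localization.Away s) :=
      (IsLocalization.injective (Localization.Away s)
        (powers_le_nonZeroDivisors_of_noZeroDivisors hs)).nontrivial
    have : Nonempty (Spec (.of (Localization.Away s))) :=
      inferInstanceAs (Nonempty (PrimeSpectrum (Localization.Away s)))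
    exact Set.range_nonempty j
  · rw [← he, Category.assoc, Category.assoc, Category.assoc, Category.assoc, ← hγ, ← hα,
      ← Spec.map_comp, ← Spec.map_comp]
    congr 2
    ext r
    exact congr($hχ₁ r)
  · intro x y hxy
    obtain ⟨t, ht⟩ : ∃ t, j t = j.opensRange.ι y := y.2
    have hey : e.inv y = t := by
      apply j.isOpenEmbedding.injective
      rw [← Scheme.Hom.comp_apply, he, ht]
    have hxX₁ : x ∈ X₁ := by
      change π₁.left x ∈ V₁
      rw [hxy]
      exact hle y.2
    obtain ⟨w, hw⟩ := hq ⟨x, hxX₁⟩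
    have hgw : g w = x := by
      rw [Scheme.Hom.comp_apply, hw]
      rfl
    have hwt : Spec.map φ w = Spec.map (CommRingCat.ofHom (algebraMap _ (Localization.Away s))) t := by
      apply f₁.isOpenEmbedding.injective
      rw [← Scheme.Hom.comp_apply, hφ', Scheme.Hom.comp_apply, hgw, hxy, ← ht]
      rfl
    -- Since `t` lies where `s` is invertible, `w` lifts to the localization of `B` at `φ s`, the
    -- ring in which `χ` and `ψ` can be compared.
    have hsw : φ.hom s ∉ w.asIdeal := fun h ↦ by
      have h1 : s ∈ (Spec.map φ w).asIdeal := h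
      rw [hwt] at h1
      exact t.2.ne_top (Ideal.eq_top_of_isUnit_mem _ h1 (IsLocalization.Away.algebraMap_isUnit s))
    obtain ⟨w', hw'⟩ : ∃ w' : Spec (.of (Localization.Away (φ.hom s))),
        Spec.map (CommRingCat.ofHom (algebraMap B (Localization.Away (φ.hom s)))) w' = w := by
      have := PrimeSpectrum.localization_away_comap_range (Localization.Away (φ.hom s)) (φ.hom s)
      exact (this.ge hsw :)
    have ht' : Spec.map (CommRingCat.ofHom (Localization.awayMap φ.hom s)) w' = t := by
      have h : CommRingCat.ofHom (algebraMap _ (Localization.Away s)) ≫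
          CommRingCat.ofHom (Localization.awayMap φ.hom s) =
          φ ≫ CommRingCat.ofHom (algebraMap B (Localization.Away (φ.hom s))) := by
        ext r
        exact IsLocalization.map_eq (S := Localization.Away s) (Q := Localization.Away (φ.hom s))
          (Submonoid.map_le_iff_le_comap.1 (Submonoid.map_powers φ.hom s).le) r
      let l := Spec.map (CommRingCat.ofHom (algebraMap Γ(Y₁.left, V₁) (Localization.Away s)))
      have : IsOpenImmersion l := inferInstance
      apply l.isOpenEmbedding.injective
      rw [← hwt, ← hw', ← Scheme.Hom.comp_apply, ← Scheme.Hom.comp_apply, ← Spec.map_comp,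
        ← Spec.map_comp, h]
    have hcomp : CommRingCat.ofHom χ ≫ CommRingCat.ofHom (Localization.awayMap φ.hom s) =
        ψ ≫ CommRingCat.ofHom (algebraMap B (Localization.Away (φ.hom s))) := by
      ext r
      exact congr($hχ₂ r)
    rw [Scheme.Hom.comp_apply, hey, ← ht', ← Scheme.Hom.comp_apply, ← Category.assoc,
      ← Spec.map_comp, hcomp, Spec.map_comp, Category.assoc, hψ', Scheme.Hom.comp_apply, hw',
      Scheme.Hom.comp_apply, hgw]

end

/-! ### Maps inducing the same topology -/

section Induced

variable {T S₁ S₂ : Type*} [TopologicalSpace S₁] [TopologicalSpace S₂] {f₁ : T → S₁} {f₂ : T → S₂}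

/-- Open sets separate the points of a T0 space, and each pulled-back open set of `S₂` is also
pulled back along `f₁`, hence cannot separate points of one `f₁`-fibre. -/
theorem eq_of_induced_eq [T0Space S₂]
    (h : TopologicalSpace.induced f₁ ‹_› = TopologicalSpace.induced f₂ ‹_›) {x x' : T}
    (hx : f₁ x = f₁ x') : f₂ x = f₂ x' := by
  refine Inseparable.eq (inseparable_iff_forall_isOpen.2 fun V hV ↦ ?_)
  have hV' : @IsOpen T (TopologicalSpace.induced f₂ ‹_›) (f₂ ⁻¹' V) := ⟨V, hV, rfl⟩
  rw [← h] at hV'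
  obtain ⟨W, -, hWV⟩ := hV'
  rw [← Set.mem_preimage, ← Set.mem_preimage (a := x'), ← hWV, Set.mem_preimage, hx]
  rfl

theorem exists_opens_preimage_eq
    (h : TopologicalSpace.induced f₁ ‹_› = TopologicalSpace.induced f₂ ‹_›)
    (V : TopologicalSpace.Opens S₂) : ∃ W : TopologicalSpace.Opens S₁, f₁ ⁻¹' W = f₂ ⁻¹' V := by
  have hV' : @IsOpen T (TopologicalSpace.induced f₂ ‹_›) (f₂ ⁻¹' V) := ⟨V, V.2, rfl⟩
  rw [← h] at hV'
  obtain ⟨W, hW, hWV⟩ := hV'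
  exact ⟨⟨W, hW⟩, hWV⟩

end Induced

/-! ### Cut and paste in the Grothendieck ring -/

section

variable {k : Type u} [Field k]

section K₀

theorem K₀.of_eq_of_iso {X Y : Over (Spec (.of k))} (hX : IsVariety X) (hY : IsVariety Y)
    (e : X ≅ Y) : K₀.of X hX = K₀.of Y hY :=
  (Ideal.Quotient.eq).2 (Ideal.subset_span (.iso ⟨X, hX⟩ ⟨Y, hY⟩ e))

theorem K₀.of_eq_add {X Z U : Over (Spec (.of k))} (hX : IsVariety X) (hZ : IsVariety Z)
    (hU : IsVariety U) (i : Z ⟶ X) (j : U ⟶ X) (hi : IsClosedImmersion i.left)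
    (hj : IsOpenImmersion j.left) (hij : Set.range j.left = (Set.range i.left)ᶜ) :
    K₀.of X hX = K₀.of Z hZ + K₀.of U hU := by
  rw [K₀.of, K₀.of, K₀.of, ← map_add]
  exact (Ideal.Quotient.eq).2
    (Ideal.subset_span (.scissor ⟨X, hX⟩ ⟨Z, hZ⟩ ⟨U, hU⟩ i j hi hj hij))

/-- An empty variety is both a closed subvariety of itself and its open complement, so its class
equals twice itself. -/
theorem K₀.of_eq_zero {X : Over (Spec (.of k))} (hX : IsVariety X) [IsEmpty X.left] :
    K₀.of X hX = 0 := by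
  have h := K₀.of_eq_add hX hX hX (𝟙 X) (𝟙 X) (inferInstanceAs (IsClosedImmersion (𝟙 X.left)))
    (inferInstanceAs (IsOpenImmersion (𝟙 X.left))) (Set.ext fun x ↦ isEmptyElim x)
  simpa using h

end K₀

variable [IsAlgClosed k] [CharZero k]

/-- If `π₁ : X ⟶ Y₁` and `π₂ : X ⟶ Y₂` are surjective and the Zariski topologies of `Y₁` and
`Y₂` pull back to the same topology of `X`, then `Y₁` and `Y₂` have isomorphic nonempty open
subschemes. -/
theorem exists_opens_iso {X Y₁ Y₂ : Over (Spec (.of k))} (hX : IsVariety X) (hY₁ : IsVariety Y₁)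
    (hY₂ : IsVariety Y₂) (π₁ : X ⟶ Y₁) (π₂ : X ⟶ Y₂) (h₁ : Function.Surjective π₁.left)
    (h₂ : Function.Surjective π₂.left)
    (h : TopologicalSpace.induced π₁.left inferInstance =
      TopologicalSpace.induced π₂.left inferInstance) [Nonempty Y₁.left] :
    ∃ (U : Y₁.left.Opens) (V : Y₂.left.Opens), (U : Set Y₁.left).Nonempty ∧
      π₁.left ⁻¹' U = π₂.left ⁻¹' V ∧
      Nonempty (Over.mk (U.ι ≫ Y₁.hom) ≅ Over.mk (V.ι ≫ Y₂.hom)) := by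
  have := hY₁.1
  have := hY₂.1
  have := hY₁.2
  have := hY₂.2
  have := hY₁.3
  have := hY₂.3
  obtain ⟨U₁, -, hU₁, φ, hφ, hφπ⟩ := exists_opens_hom hX hY₁ hY₂ π₁ π₂ h₁
    (fun _ _ ↦ eq_of_induced_eq h) ⊤ ⟨Classical.arbitrary _, trivial⟩
    (fun V ↦ (exists_opens_preimage_eq h V).imp fun _ hW ↦ SetLike.coe_injective hW)
  obtain ⟨O₂, hO₂⟩ := exists_opens_preimage_eq h.symm U₁
  obtain ⟨y₁, hy₁⟩ := hU₁
  obtain ⟨x₁, rfl⟩ := h₁ y₁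
  -- Searching for `V` inside `O₂`, the counterpart of `U₁`, ensures that `φ` is defined on the open
  -- `U` corresponding to `V`.
  obtain ⟨V, hVO, hV, ψ, hψ, hψπ⟩ := exists_opens_hom hX hY₂ hY₁ π₂ π₁ h₂
    (fun _ _ ↦ eq_of_induced_eq h.symm) O₂ ⟨π₂.left x₁, hO₂.ge hy₁⟩
    (fun V ↦ (exists_opens_preimage_eq h.symm V).imp fun _ hW ↦ SetLike.coe_injective hW)
  obtain ⟨(U : Y₁.left.Opens), hU⟩ := exists_opens_preimage_eq h V
  have hUU₁ : U ≤ U₁ := by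
    intro y hy
    obtain ⟨x, rfl⟩ := h₁ y
    exact hO₂.le (hVO (hU.le hy))
  have hφr (x : X.left) (y : (U : Scheme.{u})) (hxy : π₁.left x = U.ι y) :
      (Y₁.left.homOfLE hUU₁ ≫ φ) y = π₂.left x :=
    hφπ x (Y₁.left.homOfLE hUU₁ y) (by
      rw [hxy, ← Scheme.Hom.comp_apply, Scheme.homOfLE_ι])
  let a : (U : Scheme.{u}) ⟶ V := IsOpenImmersion.lift V.ι (Y₁.left.homOfLE hUU₁ ≫ φ) (by
    rintro _ ⟨y, rfl⟩
    obtain ⟨x, hx⟩ := h₁ (U.ι y)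
    rw [hφr x y hx, Scheme.Opens.range_ι]
    refine hU.le (?_ : π₁.left x ∈ U)
    rw [hx]
    exact y.2)
  let b : (V : Scheme.{u}) ⟶ U := IsOpenImmersion.lift U.ι ψ (by
    rintro _ ⟨z, rfl⟩
    obtain ⟨x, hx⟩ := h₂ (V.ι z)
    rw [hψπ x z hx, Scheme.Opens.range_ι]
    refine hU.ge (?_ : π₂.left x ∈ V)
    rw [hx]
    exact z.2)
  have ha : a ≫ V.ι = Y₁.left.homOfLE hUU₁ ≫ φ := IsOpenImmersion.lift_fac _ _ _
  have hb : b ≫ U.ι = ψ := IsOpenImmersion.lift_fac _ _ _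
  have haw : a ≫ V.ι ≫ Y₂.hom = U.ι ≫ Y₁.hom := by
    rw [reassoc_of% ha, hφ, Scheme.homOfLE_ι_assoc]
  have hbw : b ≫ U.ι ≫ Y₁.hom = V.ι ≫ Y₂.hom := by
    rw [reassoc_of% hb, hψ]
  have hab : a ≫ b = 𝟙 _ := by
    rw [← cancel_mono U.ι, Category.assoc, hb, Category.id_comp]
    have hw : (a ≫ ψ) ≫ Y₁.hom = U.ι ≫ Y₁.hom := by rw [Category.assoc, hψ, haw]
    have : LocallyOfFiniteType ((a ≫ ψ) ≫ Y₁.hom) := by rw [hw]; infer_instance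
    -- It is enough to compare the two maps on points, and every point of `U` is the image of a
    -- point of `X`.
    refine ext_of_apply_eq Y₁.hom Set.univ isClosed_univ.isLocallyClosed dense_univ
      (fun y _ _ ↦ ?_) hw
    obtain ⟨x, hx⟩ := h₁ (U.ι y)
    rw [Scheme.Hom.comp_apply, hψπ x (a y) (by rw [← Scheme.Hom.comp_apply, ha, hφr x y hx]), hx]
  have hba : b ≫ a = 𝟙 _ := by
    rw [← cancel_mono V.ι, Category.assoc, ha, Category.id_comp]
    have hw : (b ≫ Y₁.left.homOfLE hUU₁ ≫ φ) ≫ Y₂.hom = V.ι ≫ Y₂.hom := by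
      rw [← ha, Category.assoc, Category.assoc, haw, hbw]
    have : LocallyOfFiniteType ((b ≫ Y₁.left.homOfLE hUU₁ ≫ φ) ≫ Y₂.hom) := by
      rw [hw]; infer_instance
    refine ext_of_apply_eq Y₂.hom Set.univ isClosed_univ.isLocallyClosed dense_univ
      (fun z _ _ ↦ ?_) hw
    obtain ⟨x, hx⟩ := h₂ (V.ι z)
    rw [Scheme.Hom.comp_apply, hφr x (b z) (by rw [← Scheme.Hom.comp_apply, hb, hψπ x z hx]), hx]
  obtain ⟨z, hz⟩ := hV
  obtain ⟨x, rfl⟩ := h₂ z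
  exact ⟨U, V, ⟨π₁.left x, hU.ge hz⟩, hU,
    ⟨Over.isoMk ⟨a, b, hab, hba⟩ haw⟩⟩

/-- If `π₁ : X ⟶ Y₁` and `π₂ : X ⟶ Y₂` are surjective and the Zariski topologies of `Y₁` and
`Y₂` pull back to the same topology of `X`, then `[Y₁] = [Y₂]`. -/
theorem K₀.of_eq_of_induced_eq {T : Type*} [TopologicalSpace T] [TopologicalSpace.NoetherianSpace T]
    (C : TopologicalSpace.Closeds T) :
    ∀ {X Y₁ Y₂ : Over (Spec (.of k))} (_ : IsVariety X) (hY₁ : IsVariety Y₁)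
      (hY₂ : IsVariety Y₂) (π₁ : X ⟶ Y₁) (π₂ : X ⟶ Y₂) (_ : Function.Surjective π₁.left)
      (_ : Function.Surjective π₂.left)
      (_ : TopologicalSpace.induced π₁.left inferInstance =
        TopologicalSpace.induced π₂.left inferInstance)
      (e : Y₁.left → T) (_ : Topology.IsClosedEmbedding e) (_ : Set.range e = C),
      K₀.of Y₁ hY₁ = K₀.of Y₂ hY₂ := by
  -- Noetherian induction in a fixed ambient space `T`, with all varieties and maps left free:
  -- passing to a complement replaces `Y₁` by a different scheme, but its image in `T` shrinks.
  induction C using WellFoundedLT.induction with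
  | _ C ih =>
  intro X Y₁ Y₂ hX hY₁ hY₂ π₁ π₂ h₁ h₂ h e he heC
  by_cases hne : Nonempty Y₁.left
  · obtain ⟨U, V, hU, hUV, ⟨ε⟩⟩ := exists_opens_iso hX hY₁ hY₂ π₁ π₂ h₁ h₂ h
    have hUvar := hY₁.of_isOpenImmersion U.ι
    have hVvar := hY₂.of_isOpenImmersion V.ι
    obtain ⟨Z₁, i₁, hi₁, hZ₁, hr₁, hl₁⟩ := exists_reduced_closedSubscheme (U : Set Y₁.left)ᶜ
      U.2.isClosed_compl
    obtain ⟨Z₂, i₂, hi₂, hZ₂, hr₂, hl₂⟩ := exists_reduced_closedSubscheme (V : Set Y₂.left)ᶜ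
      V.2.isClosed_compl
    -- By `hUV` the complements of `U` and `V` have the same preimage, so one `X'` serves both.
    obtain ⟨X', i, hi, hX', hr, -⟩ := exists_reduced_closedSubscheme
      (π₁.left ⁻¹' (U : Set Y₁.left)ᶜ) (U.2.isClosed_compl.preimage π₁.left.continuous)
    have hZ₁var := hY₁.of_isClosedImmersion i₁
    have hZ₂var := hY₂.of_isClosedImmersion i₂
    have hX'var := hX.of_isClosedImmersion i
    obtain ⟨ρ₁, hρ₁⟩ := hl₁ X' (i ≫ π₁.left) hX' (by
      rintro _ ⟨x, rfl⟩
      exact hr.le ⟨x, rfl⟩)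
    obtain ⟨ρ₂, hρ₂⟩ := hl₂ X' (i ≫ π₂.left) hX' (by
      rintro _ ⟨x, rfl⟩ hx
      exact hr.le ⟨x, rfl⟩ (hUV.ge hx))
    rw [K₀.of_eq_add hY₁ hZ₁var hUvar (Over.homMk i₁) (Over.homMk U.ι) hi₁
        (by exact inferInstanceAs (IsOpenImmersion U.ι)) (by
          change Set.range U.ι = (Set.range i₁)ᶜ
          rw [hr₁, Scheme.Opens.range_ι, compl_compl]),
      K₀.of_eq_add hY₂ hZ₂var hVvar (Over.homMk i₂) (Over.homMk V.ι) hi₂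
        (by exact inferInstanceAs (IsOpenImmersion V.ι)) (by
          change Set.range V.ι = (Set.range i₂)ᶜ
          rw [hr₂, Scheme.Opens.range_ι, compl_compl]), K₀.of_eq_of_iso hUvar hVvar ε]
    congr 1
    have hcl := i₁.isClosedEmbedding
    have hcl₂ := i₂.isClosedEmbedding
    have hρ₁' (x : X') : i₁ (ρ₁ x) = π₁.left (i x) := congr($hρ₁ x)
    have hρ₂' (x : X') : i₂ (ρ₂ x) = π₂.left (i x) := congr($hρ₂ x)
    have hs₁ : Function.Surjective ρ₁ := fun z ↦ by
      obtain ⟨x, hx⟩ := h₁ (i₁ z)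
      obtain ⟨x', rfl⟩ := hr.ge (show π₁.left x ∈ (U : Set Y₁.left)ᶜ from
        hx ▸ hr₁.le ⟨z, rfl⟩)
      exact ⟨x', hcl.injective ((hρ₁' x').trans hx)⟩
    have hs₂ : Function.Surjective ρ₂ := fun z ↦ by
      obtain ⟨x, hx⟩ := h₂ (i₂ z)
      obtain ⟨x', rfl⟩ := hr.ge (show π₁.left x ∈ (U : Set Y₁.left)ᶜ from fun hxU ↦
        (hr₂.le ⟨z, rfl⟩ : i₂ z ∈ (V : Set Y₂.left)ᶜ) (hx ▸ hUV.le hxU))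
      exact ⟨x', hcl₂.injective ((hρ₂' x').trans hx)⟩
    refine ih ⟨e '' (U : Set Y₁.left)ᶜ, he.isClosedMap _ U.2.isClosed_compl⟩ ?_ hX'var hZ₁var hZ₂var
      (Over.homMk ρ₁ (by simp [reassoc_of% hρ₁])) (Over.homMk ρ₂ (by simp [reassoc_of% hρ₂]))
      hs₁ hs₂ ?_ (e ∘ i₁) (he.comp hcl) ?_
    · refine lt_of_le_of_ne (fun t ht ↦ ?_) fun heq ↦ ?_
      · obtain ⟨y, -, rfl⟩ := ht
        exact heC.le ⟨y, rfl⟩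
      · obtain ⟨y, hy⟩ := hU
        have : e y ∈ e '' (U : Set Y₁.left)ᶜ :=
          (congr_arg (fun D : TopologicalSpace.Closeds T ↦ (D : Set T)) heq).ge (heC.le ⟨y, rfl⟩)
        exact (he.injective.mem_set_image.1 this) hy
    · change TopologicalSpace.induced ρ₁ Z₁.instTopologicalSpaceCarrierCarrier =
        TopologicalSpace.induced ρ₂ Z₂.instTopologicalSpaceCarrierCarrier
      -- Closed embeddings carry the induced topology, so both sides are restrictions to `X'` of the
      -- topologies pulled back to `X`.
      rw [hcl.eq_induced, hcl₂.eq_induced, induced_compose, induced_compose,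
        show i₁ ∘ ρ₁ = π₁.left ∘ i from funext hρ₁', show i₂ ∘ ρ₂ = π₂.left ∘ i from funext hρ₂',
        ← induced_compose, ← induced_compose]
      exact congr_arg _ h
    · rw [Set.range_comp, hr₁]
      rfl
  · have : IsEmpty Y₁.left := not_nonempty_iff.1 hne
    have : IsEmpty X.left := ⟨fun x ↦ isEmptyElim (π₁.left x)⟩
    have : IsEmpty Y₂.left := h₂.isEmpty
    rw [K₀.of_eq_zero, K₀.of_eq_zero]

end

/-- A nonempty constructible subset of a Jacobson space contains a closed point. -/
theorem nonempty_inter_closedPoints_of_isConstructible {T : Type*} [TopologicalSpace T]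
    [JacobsonSpace T] {S : Set T} (hS : Topology.IsConstructible S) (hne : S.Nonempty) :
    (S ∩ closedPoints T).Nonempty := by
  induction S, hS using BooleanSubalgebra.closure_sdiff_sup_induction with
  | isSublattice =>
    exact ⟨fun U hU V hV ↦ ⟨hU.1.union hV.1, hU.2.union hV.2⟩,
      fun U hU V hV ↦ ⟨hU.1.inter hV.1, hU.2.inter_isOpen hV.2 hV.1⟩⟩
  | bot_mem => exact ⟨isOpen_empty, .empty⟩
  | top_mem => exact ⟨isOpen_univ, .univ⟩
  | sdiff U hU V hV =>
    exact nonempty_inter_closedPoints hne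
      (hU.1.isLocallyClosed.inter hV.1.isClosed_compl.isLocallyClosed)
  | sup S hS S' hS' ih ih' =>
    rcases Set.union_nonempty.1 hne with h | h
    · exact (ih h).mono (Set.inter_subset_inter_left _ Set.subset_union_left)
    · exact (ih' h).mono (Set.inter_subset_inter_left _ Set.subset_union_right)

/-! ### Topology of pseudo-quotients, and values of invariant functions -/

section

variable {k : Type u} [Field k] (G : Over (Spec (.of k))) [GrpObj G]
  {X Y : Over (Spec (.of k))} [ModObj G X]

variable {G} in
theorem IsInvariantHom.translate_comp {π : X ⟶ Y} (h : IsInvariantHom G π)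
    (g : 𝟙_ (Over (Spec (.of k))) ⟶ G) : translate g X ≫ π = π := by
  rw [translate, Category.assoc, h, lift_snd_assoc, Category.id_comp]

variable {G} in
theorem IsInvariantHom.translate_apply {π : X ⟶ Y} (h : IsInvariantHom G π)
    (g : 𝟙_ (Over (Spec (.of k))) ⟶ G) (x : X.left) :
    π.left ((translate g X).left x) = π.left x := by
  rw [← Scheme.Hom.comp_apply, ← Over.comp_left, h.translate_comp]

variable {G} in
theorem IsInvariantHom.isInvariantSet_preimage {π : X ⟶ Y} (h : IsInvariantHom G π)
    (S : Set Y.left) : IsInvariantSet G (π.left ⁻¹' S) := fun g x hx ↦ by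
  rwa [Set.mem_preimage, h.translate_apply g x]

variable {G}

/-- Pseudo-quotients induce the same topology: closed sets of `Y₁` correspond to closed sets of
`Y₂`. -/
theorem IsPseudoQuotient.exists_isClosed_preimage_eq {Y₁ Y₂ : Over (Spec (.of k))}
    (hX : IsVariety X) (hY₁ : IsVariety Y₁) {π₁ : X ⟶ Y₁} {π₂ : X ⟶ Y₂}
    (h₁ : IsPseudoQuotient G π₁) (h₂ : IsPseudoQuotient G π₂) (Z : Set Y₁.left) (hZ : IsClosed Z) :
    ∃ Z' : Set Y₂.left, IsClosed Z' ∧ π₂.left ⁻¹' Z' = π₁.left ⁻¹' Z := by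
  have := hX.jacobsonSpace
  have := hY₁.jacobsonSpace
  have := hX.3
  have : LocallyOfFiniteType (π₁.left ≫ Y₁.hom) := by rw [Over.w]; infer_instance
  have : LocallyOfFiniteType π₁.left := locallyOfFiniteType_of_comp π₁.left Y₁.hom
  let W := π₁.left ⁻¹' Z
  have hW : IsClosed W := hZ.preimage π₁.left.continuous
  refine ⟨closure (π₂.left '' W), isClosed_closure, Set.Subset.antisymm ?_
    fun x hx ↦ subset_closure ⟨x, hx, rfl⟩⟩
  by_contra hsub
  obtain ⟨x₀, hx₀, hx₀W⟩ := Set.not_subset.1 hsub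
  have hlc : IsLocallyClosed (π₂.left ⁻¹' closure (π₂.left '' W) ∩ Wᶜ) :=
    (isClosed_closure.preimage π₂.left.continuous).isLocallyClosed.inter
      hW.isOpen_compl.isLocallyClosed
  have hne : (π₂.left ⁻¹' closure (π₂.left '' W) ∩ Wᶜ).Nonempty := ⟨x₀, hx₀, hx₀W⟩
  -- A closed point is needed so that its `π₁`-fibre is closed; the offending set is locally closed,
  -- so it contains one.
  obtain ⟨x, ⟨hx, hxW⟩, hxc⟩ := nonempty_inter_closedPoints hne hlc
  have hy : IsClosed {π₁.left x} := π₁.left.closePoints_subset_preimage_closedPoints hxc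
  have hdisj : Disjoint (π₁.left ⁻¹' {π₁.left x}) W := Set.disjoint_left.2 fun z hz hzW ↦ by
    refine hxW (?_ : π₁.left x ∈ Z)
    rw [← show π₁.left z = π₁.left x from hz]
    exact hzW
  exact Set.disjoint_left.1 (h₂.disjoint_closure _ W (hy.preimage π₁.left.continuous) hW
    (h₁.invariant.isInvariantSet_preimage _) (h₁.invariant.isInvariantSet_preimage _) hdisj)
    (subset_closure ⟨x, rfl, rfl⟩) hx

/-- Apart from surjectivity, this is all that the equality of classes uses about pseudo-quotients.
-/
theorem IsPseudoQuotient.induced_eq {Y₁ Y₂ : Over (Spec (.of k))}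
    (hX : IsVariety X) (hY₁ : IsVariety Y₁) (hY₂ : IsVariety Y₂) {π₁ : X ⟶ Y₁} {π₂ : X ⟶ Y₂}
    (h₁ : IsPseudoQuotient G π₁) (h₂ : IsPseudoQuotient G π₂) :
    TopologicalSpace.induced π₁.left inferInstance =
      TopologicalSpace.induced π₂.left inferInstance := by
  refine TopologicalSpace.ext_iff_isClosed.2 fun W ↦ ?_
  rw [isClosed_induced_iff, isClosed_induced_iff]
  constructor
  · rintro ⟨Z, hZ, rfl⟩
    exact h₁.exists_isClosed_preimage_eq hX hY₁ h₂ Z hZ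
  · rintro ⟨Z, hZ, rfl⟩
    exact h₂.exists_isClosed_preimage_eq hX hY₂ h₁ Z hZ

/-- By Chevalley, the points of the closure missing from the image form a constructible set. If it
were nonempty it would contain a closed point, whose fibre is an invariant closed set disjoint from
`W`, contradicting the separation of closures. -/
theorem IsPseudoQuotient.isClosed_image (hX : IsVariety X) (hY : IsVariety Y) {π : X ⟶ Y}
    (h : IsPseudoQuotient G π) (W : Set X.left) (hW : IsClosed W) (hGW : IsInvariantSet G W) :
    IsClosed (π.left '' W) := by
  have := hY.jacobsonSpace
  have := hX.isNoetherian
  have := hY.isNoetherian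
  have := hX.3
  have : LocallyOfFiniteType (π.left ≫ Y.hom) := by rw [Over.w]; infer_instance
  have : LocallyOfFiniteType π.left := locallyOfFiniteType_of_comp π.left Y.hom
  have hc {T : Scheme.{u}} [IsNoetherian T] {S : Set T} (hS : IsClosed S) :
      Topology.IsConstructible S := by
    rw [← compl_compl S, Topology.isConstructible_compl]
    exact (TopologicalSpace.NoetherianSpace.isCompact _).isConstructible hS.isOpen_compl
  have hcon : Topology.IsConstructible (closure (π.left '' W) \ π.left '' W) :=
    (hc isClosed_closure).sdiff (π.left.isConstructible_image (hc hW))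
  rw [← closure_subset_iff_isClosed]
  by_contra hsub
  obtain ⟨y₀, hy₀⟩ := Set.not_subset.1 hsub
  obtain ⟨y, ⟨hyW, hyn⟩, hyc⟩ := nonempty_inter_closedPoints_of_isConstructible hcon ⟨y₀, hy₀⟩
  obtain ⟨x, rfl⟩ := h.surjective y
  exact Set.disjoint_left.1 (h.disjoint_closure (π.left ⁻¹' {π.left x}) W
    (IsClosed.preimage π.left.continuous hyc) hW
    (h.invariant.isInvariantSet_preimage _) hGW
    (Set.disjoint_left.2 fun z hz hzW ↦ hyn ⟨z, hzW, hz⟩)) (subset_closure ⟨x, rfl, rfl⟩) hyW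

/-- The constant functions on an open subset of a `k`-scheme. -/
noncomputable def const (X : Over (Spec (.of k))) (O : X.left.Opens) : k →+* Γ(X.left, O) :=
  (X.hom.appLE ⊤ O le_top).hom.comp (Scheme.ΓSpecIso (.of k)).inv.hom

theorem appLE_const {X Y : Over (Spec (.of k))} (f : X ⟶ Y) (U : Y.left.Opens) (V : X.left.Opens)
    (e : V ≤ f.left ⁻¹ᵁ U) (c : k) : f.left.appLE U V e (const Y U c) = const X V c := by
  have h : Y.hom.appLE ⊤ U le_top ≫ f.left.appLE U V e = X.hom.appLE ⊤ V le_top := by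
    refine (Scheme.Hom.appLE_comp_appLE f.left Y.hom ⊤ U V le_top e).trans ?_
    simp only [Over.w]
  exact congr($h _)

theorem map_const {X : Over (Spec (.of k))} {U V : X.left.Opens} (i : V ⟶ U) (c : k) :
    X.left.presheaf.map i.op (const X U c) = const X V c := by
  have h : X.hom.appLE ⊤ U le_top ≫ X.left.presheaf.map i.op = X.hom.appLE ⊤ V le_top :=
    Scheme.Hom.appLE_map _ _ _
  exact congr($h _)

/-- Invariant functions are constant on the closed fibres of a pseudo-quotient. -/
theorem IsPseudoQuotient.eq_of_notMem_basicOpen {π : X ⟶ Y} (h : IsPseudoQuotient G π)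
    (U : Y.left.Opens) (f : Γ(X.left, π.left ⁻¹ᵁ U)) (hf : IsInvariantSection G f)
    {x x' : X.left} (hxU : π.left x ∈ U) (hc : IsClosed {π.left x}) (hxx' : π.left x' = π.left x)
    (c c' : k) (hx : x ∉ X.left.basicOpen (f - const X _ c))
    (hx' : x' ∉ X.left.basicOpen (f - const X _ c')) : c = c' := by
  by_contra hne
  -- The locus in the fibre where `f` takes the value `c`. Two such loci are disjoint because `f -
  -- c` and `f - c'` differ by a unit.
  let W (c : k) : Set X.left :=
    π.left ⁻¹' {π.left x} ∩ (X.left.basicOpen (f - const X _ c) : Set X.left)ᶜ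
  have hW (c) : IsClosed (W c) :=
    (hc.preimage π.left.continuous).inter (X.left.basicOpen _).2.isClosed_compl
  have hGW (c) : IsInvariantSet G (W c) := by
    rintro g z ⟨hz, hzc⟩
    refine ⟨h.invariant.isInvariantSet_preimage _ g z hz, fun hgz ↦ hzc ?_⟩
    obtain ⟨hle, hg⟩ := hf g
    have h1 : (translate g X).left.appLE _ _ hle (f - const X _ c) = f - const X _ c := by
      rw [map_sub, hg, appLE_const]
    rw [SetLike.mem_coe, ← h1, Scheme.basicOpen_appLE]
    exact ⟨show π.left z ∈ U from (show π.left z = π.left x from hz) ▸ hxU, hgz⟩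
  have hdisj : Disjoint (W c) (W c') := Set.disjoint_left.2 fun z ⟨hz, hzc⟩ ⟨_, hzc'⟩ ↦ by
    have hzU : z ∈ π.left ⁻¹ᵁ U :=
      show π.left z ∈ U from (show π.left z = π.left x from hz) ▸ hxU
    rw [Set.mem_compl_iff, SetLike.mem_coe, Scheme.mem_basicOpen _ _ _ hzU,
      ← mem_nonunits_iff, ← IsLocalRing.mem_maximalIdeal] at hzc hzc'
    have h2 := sub_mem hzc' hzc
    rw [← map_sub, sub_sub_sub_cancel_left, ← map_sub, IsLocalRing.mem_maximalIdeal,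
      mem_nonunits_iff] at h2
    exact h2 (((sub_ne_zero.2 hne).isUnit.map (const X _)).map _)
  exact Set.disjoint_left.1 (h.disjoint_closure _ _ (hW c) (hW c') (hGW c) (hGW c') hdisj)
    (subset_closure ⟨x, ⟨rfl, hx⟩, rfl⟩) (subset_closure ⟨x', ⟨hxx', hx'⟩, hxx'⟩)

end

/-- The sections of a normal integral scheme over an affine open subset are integrally closed. -/
theorem IsNormal.isIntegrallyClosed {Y : Scheme.{u}} [IsIntegral Y] (hY : IsNormal Y) {V : Y.Opens}
    (hV : IsAffineOpen V) [Nonempty V] : IsIntegrallyClosed Γ(Y, V) := by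
  refine IsIntegrallyClosed.of_localization_maximal fun P _ hP ↦ ?_
  have hPV : hV.fromSpec ⟨P, hP.isPrime⟩ ∈ V := hV.range_fromSpec.le ⟨_, rfl⟩
  let _ := Y.presheaf.algebra_section_stalk ⟨_, hPV⟩
  have : IsLocalization.AtPrime (Y.presheaf.stalk (hV.fromSpec ⟨P, hP.isPrime⟩)) P :=
    hV.isLocalization_stalk' ⟨P, hP.isPrime⟩ hPV
  have := (hY (hV.fromSpec ⟨P, hP.isPrime⟩)).2
  exact .of_equiv (IsLocalization.algEquiv P.primeCompl
    (Y.presheaf.stalk (hV.fromSpec ⟨P, hP.isPrime⟩)) (Localization.AtPrime P)).toRingEquiv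

/-! ### Descent of invariant functions to a normal base -/

section

variable {k : Type u} [Field k]

theorem fromSpec_hom (X : Over (Spec (.of k))) {V : X.left.Opens} (hV : IsAffineOpen V) :
    hV.fromSpec ≫ X.hom = Spec.map (CommRingCat.ofHom (const X V)) := by
  rw [← IsAffineOpen.SpecMap_appLE_fromSpec X.hom (isAffineOpen_top _) hV le_top,
    IsAffineOpen.fromSpec_top, Scheme.isoSpec_Spec_inv, ← Spec.map_comp]
  rfl

theorem const_finiteType {X : Over (Spec (.of k))} (hX : IsVariety X) {V : X.left.Opens}
    (hV : IsAffineOpen V) : (const X V).FiniteType := by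
  have := hX.3
  rw [← CommRingCat.hom_ofHom (const X V), ← HasRingHomProperty.Spec_iff
    (P := @LocallyOfFiniteType), ← fromSpec_hom X hV]
  infer_instance

/-- The image of a rational point is closed. -/
theorem isClosed_singleton_of_comp_eq_id (Y : Over (Spec (.of k))) (q : Spec (.of k) ⟶ Y.left)
    (hq : q ≫ Y.hom = 𝟙 _) (t : Spec (.of k)) : IsClosed {q t} := by
  have : Subsingleton (Spec (.of k)) := inferInstanceAs (Subsingleton (PrimeSpectrum k))
  have := isClosedImmersion_of_comp_eq_id Y.hom q hq
  have h : Set.range q = {q t} :=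
    Set.eq_singleton_iff_unique_mem.2 ⟨⟨t, rfl⟩, by
      rintro _ ⟨t', rfl⟩
      rw [Subsingleton.elim t' t]⟩
  rw [← h]
  exact q.isClosedEmbedding.isClosed_range

variable {G : Over (Spec (.of k))} [GrpObj G] {X Y : Over (Spec (.of k))} [ModObj G X]

variable [IsAlgClosed k] [CharZero k]

/-- An invariant function is a fraction of functions on the pseudo-quotient. -/
theorem IsPseudoQuotient.exists_app_mul_eq (hX : IsVariety X) {π : X ⟶ Y}
    (h : IsPseudoQuotient G π) [IsIntegral X.left] [IsIntegral Y.left]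
    (U : Y.left.Opens) (f : Γ(X.left, π.left ⁻¹ᵁ U)) (hf : IsInvariantSection G f)
    {V : Y.left.Opens} (hV : IsAffineOpen V) [Nonempty V] (i : V ⟶ U) :
    ∃ s b : Γ(Y.left, V), s ≠ 0 ∧ π.left.app V s *
      X.left.presheaf.map ((TopologicalSpace.Opens.map π.left.base).map i).op f =
        π.left.app V b := by
  obtain ⟨⟨y, hyV⟩⟩ := ‹Nonempty V›
  obtain ⟨x₀, rfl⟩ := h.surjective y
  obtain ⟨V', hV', hxV', hle⟩ := exists_isAffineOpen_mem_and_subset (U := π.left ⁻¹ᵁ V) hyV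
  have : Nonempty V := ⟨⟨_, hyV⟩⟩
  have : Nonempty V' := ⟨⟨_, hxV'⟩⟩
  let j : V' ⟶ π.left ⁻¹ᵁ V := homOfLE hle
  let l : V' ⟶ π.left ⁻¹ᵁ U := j ≫ (TopologicalSpace.Opens.map π.left.base).map i
  let φ : Γ(Y.left, V) →+* Γ(X.left, V') := (π.left.appLE V V' hle).hom
  let f' : Γ(X.left, V') := X.left.presheaf.map l.op f
  have hφ : φ.comp (const Y V) = const X V' := RingHom.ext (appLE_const π V V' hle)
  -- At the rational point given by `x`, the function `f` takes the value `x f'`.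
  have key (x : Γ(X.left, V') →+* k) (hx : x.comp (const X V') = .id k) (t : Spec (.of k)) :
      hV'.fromSpec (Spec.map (CommRingCat.ofHom x) t) ∉
        X.left.basicOpen (f - const X _ (x f')) := by
    intro hmem
    have h1 : hV'.fromSpec (Spec.map (CommRingCat.ofHom x) t) ∈
        X.left.basicOpen (X.left.presheaf.map l.op (f - const X _ (x f'))) := by
      rw [Scheme.basicOpen_res]
      exact ⟨hV'.range_fromSpec.le ⟨_, rfl⟩, hmem⟩
    have h2 : Spec.map (CommRingCat.ofHom x) t ∈ hV'.fromSpec ⁻¹ᵁ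
        X.left.basicOpen (X.left.presheaf.map l.op (f - const X _ (x f'))) := h1
    rw [hV'.fromSpec_preimage_basicOpen] at h2
    refine h2 (?_ : x (X.left.presheaf.map l.op (f - const X _ (x f'))) ∈ t.asIdeal)
    have h3 : x (const X V' (x f')) = x f' := congr($hx _)
    rw [map_sub, map_const, map_sub, h3, sub_self]
    exact zero_mem _
  have hpt (x : Γ(X.left, V') →+* k) (t : Spec (.of k)) :
      π.left (hV'.fromSpec (Spec.map (CommRingCat.ofHom x) t)) =
        hV.fromSpec (Spec.map (CommRingCat.ofHom (x.comp φ)) t) := by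
    have h1 := IsAffineOpen.SpecMap_appLE_fromSpec π.left hV hV' hle
    rw [← Scheme.Hom.comp_apply, ← h1]
    rfl
  have hcl (x : Γ(X.left, V') →+* k) (hx : x.comp (const X V') = .id k) (t : Spec (.of k)) :
      IsClosed {π.left (hV'.fromSpec (Spec.map (CommRingCat.ofHom x) t))} := by
    refine isClosed_singleton_of_comp_eq_id Y
      (Spec.map (CommRingCat.ofHom x) ≫ hV'.fromSpec ≫ π.left) ?_ t
    rw [Category.assoc, Category.assoc, Over.w, fromSpec_hom, ← Spec.map_comp, ← Spec.map_id]
    congr 1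
    ext r
    exact congr($hx r)
  have hex : ∃ s b : Γ(Y.left, V), s ≠ 0 ∧ φ s * f' = φ b := by
    have hft := const_finiteType hX hV'
    rw [← hφ] at hft
    algebraize [const Y V, φ, φ.comp (const Y V)]
    obtain ⟨s, b, hs, hb⟩ := exists_mul_eq_algebraMap (k := k) (A := Γ(Y.left, V)) f'
      fun x x' hxx' ↦ by
        have hx : x.toRingHom.comp (const X V') = .id k := by
          rw [← hφ]
          exact RingHom.ext fun r ↦ x.commutes r
        have hx' : x'.toRingHom.comp (const X V') = .id k := by
          rw [← hφ]
          exact RingHom.ext fun r ↦ x'.commutes r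
        have hφx : x'.toRingHom.comp φ = x.toRingHom.comp φ :=
          RingHom.ext fun a ↦ (hxx' a).symm
        let t : Spec (.of k) := IsLocalRing.closedPoint k
        refine h.eq_of_notMem_basicOpen U f hf ?_ (hcl x.toRingHom hx t) ?_ _ _
          (key x.toRingHom hx t) (key x'.toRingHom hx' t)
        · rw [hpt]
          exact i.le (hV.range_fromSpec.le ⟨_, rfl⟩)
        · rw [hpt, hpt, hφx]
    exact ⟨s, b, hs, hb⟩
  obtain ⟨s, b, hs, hb⟩ := hex
  -- The relation found on `V'` extends to the whole preimage of `V`, as restriction is injective on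
  -- the integral scheme `X`.
  refine ⟨s, b, hs, map_injective_of_isIntegral X.left j ?_⟩
  have h1 (a) : X.left.presheaf.map j.op (π.left.app V a) = φ a := rfl
  rw [map_mul, h1, h1, ← hb]
  congr 1
  rw [← ConcreteCategory.comp_apply, ← Functor.map_comp]
  rfl

/-- An invariant function descends to affine open subsets of a normal pseudo-quotient. -/
theorem IsPseudoQuotient.exists_app_eq (hX : IsVariety X) (hY : IsVariety Y) {π : X ⟶ Y}
    (h : IsPseudoQuotient G π) [IsIntegral X.left] [IsIntegral Y.left] (hn : IsNormal Y.left)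
    (hinj : ∀ U, Function.Injective (π.left.app U))
    (U : Y.left.Opens) (f : Γ(X.left, π.left ⁻¹ᵁ U)) (hf : IsInvariantSection G f)
    {V : Y.left.Opens} (hV : IsAffineOpen V) [Nonempty V] (i : V ⟶ U) :
    ∃ a : Γ(Y.left, V), π.left.app V a =
      X.left.presheaf.map ((TopologicalSpace.Opens.map π.left.base).map i).op f := by
  have := hY.isNoetherian
  obtain ⟨s, b, hs, hb⟩ := h.exists_app_mul_eq hX U f hf hV i
  have : IsNoetherianRing Γ(Y.left, V) := IsLocallyNoetherian.component_noetherian ⟨V, hV⟩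
  have : IsIntegrallyClosed Γ(Y.left, V) := hn.isIntegrallyClosed hV
  have : Nonempty (π.left ⁻¹ᵁ V) := by
    obtain ⟨⟨y, hy⟩⟩ := ‹Nonempty V›
    obtain ⟨x, rfl⟩ := h.surjective y
    exact ⟨⟨x, hy⟩⟩
  refine exists_algebraMap_eq_of_mul_eq (π.left.app V).hom (hinj V) (fun P hP ↦ ?_) _ s b hs hb
  obtain ⟨x, hx⟩ := h.surjective (hV.fromSpec ⟨P, hP⟩)
  have hPV : hV.fromSpec ⟨P, hP⟩ ∈ V := hV.range_fromSpec.le ⟨_, rfl⟩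
  have hxV : x ∈ π.left ⁻¹ᵁ V := by
    change π.left x ∈ V
    rwa [hx]
  -- The preimage of `V` need not be affine; the functions on it vanishing at a point `x` above `P`
  -- still form a prime ideal lying over `P`.
  refine ⟨(IsLocalRing.maximalIdeal _).comap (X.left.presheaf.germ (π.left ⁻¹ᵁ V) x hxV).hom,
    inferInstance, ?_⟩
  ext a
  have h1 : x ∈ X.left.basicOpen (π.left.app V a) ↔ a ∉ P := by
    rw [← Scheme.preimage_basicOpen]
    change π.left x ∈ Y.left.basicOpen a ↔ _
    rw [hx]
    change (⟨P, hP⟩ : PrimeSpectrum _) ∈ hV.fromSpec ⁻¹ᵁ Y.left.basicOpen a ↔ _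
    rw [hV.fromSpec_preimage_basicOpen]
    rfl
  rw [Scheme.mem_basicOpen _ _ _ hxV] at h1
  rw [Ideal.mem_comap, Ideal.mem_comap, IsLocalRing.mem_maximalIdeal, mem_nonunits_iff]
  exact (not_congr h1).trans not_not

theorem IsPseudoQuotient.isGoodQuotient (hX : IsVariety X) (hY : IsVariety Y) {π : X ⟶ Y}
    (h : IsPseudoQuotient G π) (hirr : IrreducibleSpace X.left) (hn : IsNormal Y.left) :
    IsGoodQuotient G π := by
  have := hX.1
  have := hY.1
  have := hX.isNoetherian
  have : IrreducibleSpace Y.left := by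
    have h1 := (IrreducibleSpace.isIrreducible_univ X.left).image π.left
      π.left.continuous.continuousOn
    rw [Set.image_univ, h.surjective.range_eq] at h1
    exact (irreducibleSpace_def _).2 h1
  have : IsIntegral X.left := isIntegral_of_irreducibleSpace_of_isReduced _
  have : IsIntegral Y.left := isIntegral_of_irreducibleSpace_of_isReduced _
  have : IsDominant π.left := ⟨h.surjective.denseRange⟩
  have : IsSchemeTheoreticallyDominant π.left := .of_isDominant _
  have hinj (U) : Function.Injective (π.left.app U) := π.left.app_injective U
  refine ⟨h.invariant, h.surjective, fun U ↦ ⟨?_, (hinj U).injOn, fun f hf ↦ ?_⟩,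
    h.isClosed_image hX hY, fun W₁ W₂ hW₁ hW₂ hG₁ hG₂ ↦ ⟨fun hd ↦
      (h.disjoint_closure W₁ W₂ hW₁ hW₂ hG₁ hG₂ hd).mono subset_closure subset_closure,
      Disjoint.of_image⟩⟩
  · intro a _ g
    have h1 : (translate g X).left ≫ π.left = π.left := by
      rw [← Over.comp_left, h.invariant.translate_comp]
    have hle : π.left ⁻¹ᵁ U ≤ (translate g X).left ⁻¹ᵁ π.left ⁻¹ᵁ U := fun x hx ↦ by
      change π.left _ ∈ U
      rwa [h.invariant.translate_apply]
    refine ⟨hle, ?_⟩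
    have h2 : π.left.app U ≫ (translate g X).left.appLE _ _ hle = π.left.app U := by
      rw [Scheme.Hom.app_eq_appLE, Scheme.Hom.appLE_comp_appLE]
      simp only [h1]
    exact congr($h2 a)
  · let ι := {V : Y.left.Opens // IsAffineOpen V ∧ (V : Set Y.left).Nonempty ∧ V ≤ U}
    have hne (V : ι) : Nonempty V.1 := V.2.2.1.to_subtype
    choose a ha using fun V : ι ↦ h.exists_app_eq hX hY hn hinj U f hf V.2.1 (homOfLE V.2.2.2)
    have hcov : U ≤ iSup fun V : ι ↦ V.1 := fun y hy ↦ by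
      obtain ⟨V, hV, hyV, hVU⟩ := exists_isAffineOpen_mem_and_subset hy
      exact TopologicalSpace.Opens.mem_iSup.2 ⟨⟨V, hV, ⟨y, hyV⟩, hVU⟩, hyV⟩
    have hres {V V' : Y.left.Opens} (i : V ⟶ V') (b : Γ(Y.left, V')) :
        π.left.app V (Y.left.presheaf.map i.op b) =
          X.left.presheaf.map ((TopologicalSpace.Opens.map π.left.base).map i).op
            (π.left.app V' b) :=
      congr($(π.left.naturality i.op) b)
    -- The local descents agree on overlaps because their pullbacks are restrictions of the same `f`
    -- and pullback is injective.
    obtain ⟨b, hb, -⟩ := Y.left.sheaf.existsUnique_gluing' (fun V : ι ↦ V.1) U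
      (fun V ↦ homOfLE V.2.2.2) hcov a fun V V' ↦ hinj _ <| by
        refine (hres _ _).trans (Eq.trans ?_ (hres _ _).symm)
        rw [ha, ha, ← ConcreteCategory.comp_apply, ← ConcreteCategory.comp_apply,
          ← Functor.map_comp, ← Functor.map_comp]
        rfl
    refine ⟨b, trivial, X.left.sheaf.eq_of_locally_eq' (fun V : ι ↦ π.left ⁻¹ᵁ V.1) _
      (fun V ↦ (TopologicalSpace.Opens.map π.left.base).map (homOfLE V.2.2.2)) (fun x hx ↦ ?_) _ _
      fun V ↦ ?_⟩
    · obtain ⟨V, hV⟩ := TopologicalSpace.Opens.mem_iSup.1 (hcov hx)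
      exact TopologicalSpace.Opens.mem_iSup.2 ⟨V, hV⟩
    · exact (hres _ _).symm.trans ((congr_arg (π.left.app V.1) (hb V)).trans (ha V))

end

end PseudoQuotient

open PseudoQuotient in
theorem mainTheorem6 {k : Type u} [Field k] [IsAlgClosed k] [CharZero k]
    (G : Over (Spec (.of k))) (hG : IsVariety G) [GrpObj G]
    (X : Over (Spec (.of k))) (hX : IsVariety X) [ModObj G X] :
    (∀ (Y₁ Y₂ : Over (Spec (.of k))) (hY₁ : IsVariety Y₁) (hY₂ : IsVariety Y₂)
      (π₁ : X ⟶ Y₁) (π₂ : X ⟶ Y₂),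
      IsPseudoQuotient G π₁ → IsPseudoQuotient G π₂ → K₀.of Y₁ hY₁ = K₀.of Y₂ hY₂) ∧
    (∀ (Y : Over (Spec (.of k))) (_ : IsVariety Y) (π : X ⟶ Y),
      IsPseudoQuotient G π → IrreducibleSpace X.left → IsNormal Y.left →
        IsGoodQuotient G π) := by
  refine ⟨fun Y₁ Y₂ hY₁ hY₂ π₁ π₂ h₁ h₂ ↦ ?_, fun Y hY π h hirr hn ↦
    h.isGoodQuotient hX hY hirr hn⟩
  -- The induction starts with `Y₁` itself as ambient space and the whole space as closed subset.
  have := hY₁.isNoetherian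
  exact K₀.of_eq_of_induced_eq ⊤ hX hY₁ hY₂ π₁ π₂ h₁.surjective h₂.surjective
    (h₁.induced_eq hX hY₁ hY₂ h₂) id .id (by simp)
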